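/- Let $X_0=\mathbb P^1_{\mathbb Q}\times\mathbb P^1_{\mathbb Q}\times\mathbb P^1_{\mathbb Q}$ with homogeneous coordinates $(a_0:a_1)$, $(b_0:b_1)$, $(c_0:c_1)$, let $l_1=V(a_1,b_1)$ and $l_2=V(a_1,c_1)$, and let $T_0=X_0\setminus V(a_0a_1b_0b_1c_0c_1)$. Let $\pi\colon X\to X_0$ be the toric variety obtained by blowing up $l_1$ and then (the strict transform of) $l_2$, let $E_1,E_2$ be the exceptional divisors above $l_1,l_2$, let $M=\pi^{-1}(V(a_0))$, $U=X\setminus(E_1\cup E_2\cup M)$ and $T=\pi^{-1}(T_0)$. Via $\pi$ one identifies $U$ with $U_0=X_0\setminus(V(a_0)\cup l_1\cup l_2)$ and $T$ with $T_0$. Let $$\mathfrak U=\mathbb P^1_{\mathbb Z}\times\mathbb P^1_{\mathbb Z}\times\mathbb P^1_{\mathbb Z}\setminus\overline{V(a_0)\cup l_1\cup l_2},$$ an integral model of $U$; thus $\mathfrak U(\mathbb Z)\subset X_0(\mathbb Q)$ is the set of rational points of $X_0$ which, neither over $\mathbb Q$ nor after reduction modulo any prime, lie on $V(a_0)\cup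 V(a_1,b_1)\cup V(a_1,c_1)$. For $P\in\mathfrak U(\mathbb Z)\cap T(\mathbb Q)$, written with integers satisfying $\gcd(a_0,a_1)=\gcd(b_0,b_1)=\gcd(c_0,c_1)=1$ (so that $a_0=\pm1$), put $$H(P)=|a_1|\,\max\{|b_0|,|b_1|\}^2\,\max\{|c_0|,|c_1|\}^2 .$$ Then for every real $B$ the set $\{P\in\mathfrak U(\mathbb Z)\cap T(\mathbb Q): H(P)\le B\}$ is finite, and its cardinality $N(B)$ satisfies $$N(B)=c\,B(\log B)^2+O\!\left(B\log B\,(\log\log B)^3\right)\qquad(B\to\infty),$$ where $$c=4\prod_p\left(1-\frac1p\right)^2\left(1+\frac2p-\frac1{p^2}-\frac1{p^3}\right)$$ is a convergent product over all primes $p$, and $c>0$. -/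

import Mathlib

/-- The set of `K`-rational points of the projective line over a field `K`. -/
abbrev ProjLine (K : Type) [Field K] : Type := Projectivization K (Fin 2 → K)

/-- The `i`-th homogeneous coordinate of a point of the projective line is zero. -/
def ProjLine.CoordVanishes {K : Type} [Field K] (i : Fin 2) (x : ProjLine K) : Prop :=
  Projectivization.lift (fun v : { v : Fin 2 → K // v ≠ 0 } => v.1 i = 0)
    (by
      rintro ⟨a, ha⟩ ⟨b, hb⟩ t (rfl : a = t • b)
      have ht : t ≠ 0 := fun h => ha (by simp [h])
      simp [ht]) x

/-- Every rational point of the projective line has coprime integral coordinates. -/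
theorem ProjLine.exists_coprime_coords (x : ProjLine ℚ) :
    ∃ v : Fin 2 → ℤ, IsCoprime (v 0) (v 1) ∧
      ∃ h : (fun i => (v i : ℚ)) ≠ 0, x = Projectivization.mk ℚ (fun i => (v i : ℚ)) h := by
  induction x using Projectivization.ind with
  | h v hv =>
    obtain ⟨b, hb⟩ := IsLocalization.exist_integer_multiples_of_finset (nonZeroDivisors ℤ)
      (Finset.univ.image v)
    have hb0 : ((b : ℤ) : ℚ) ≠ 0 := by
      exact_mod_cast nonZeroDivisors.coe_ne_zero b
    have hw : ∀ i, ∃ w : ℤ, (w : ℚ) = (b : ℤ) * v i := by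
      intro i
      obtain ⟨w, hw⟩ := hb (v i) (Finset.mem_image_of_mem _ (Finset.mem_univ i))
      exact ⟨w, by simpa using hw⟩
    choose w hw using hw
    have hne : w 0 ≠ 0 ∨ w 1 ≠ 0 := by
      by_contra! h
      apply hv
      funext i
      have hwi : w i = 0 := by fin_cases i; exacts [h.1, h.2]
      have := hw i
      rw [hwi] at this
      simpa [hb0] using this.symm
    have hg : 0 < Int.gcd (w 0) (w 1) := by
      rw [Int.gcd_pos_iff]; exact hne
    obtain ⟨g, m, n, hg0, hmn, h0, h1⟩ := Int.exists_gcd_one' hg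
    have hg0' : (g : ℚ) ≠ 0 := by exact_mod_cast hg0.ne'
    have key : ∀ i, ((![m, n] i : ℤ) : ℚ) * g = (b : ℤ) * v i := by
      intro i
      rw [← hw i]
      fin_cases i
      · simp [h0]
      · simp [h1]
    have hcop : IsCoprime m n := Int.isCoprime_iff_gcd_eq_one.2 hmn
    have hz : (fun i => ((![m, n] i : ℤ) : ℚ)) ≠ 0 := by
      intro h
      apply hv
      funext i
      have h2 := key i
      have h3 : ((![m, n] i : ℤ) : ℚ) = 0 := congrFun h i
      rw [h3, zero_mul] at h2
      simpa [hb0] using h2.symm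
    refine ⟨![m, n], hcop, hz, ?_⟩
    rw [Projectivization.mk_eq_mk_iff']
    refine ⟨(g : ℚ) / (b : ℤ), ?_⟩
    funext i
    have h2 := key i
    simp only [Pi.smul_apply, smul_eq_mul]
    field_simp
    linarith

/-- Coprime integral coordinates of a rational point of the projective line; they are unique up
to a common sign. -/
noncomputable def ProjLine.coords (x : ProjLine ℚ) : Fin 2 → ℤ :=
  (ProjLine.exists_coprime_coords x).choose

theorem ProjLine.coords_mod_ne_zero (p : ℕ) [Fact p.Prime] (x : ProjLine ℚ) :
    (fun i => (x.coords i : ZMod p)) ≠ 0 := by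
  intro h
  obtain ⟨r, s, hrs⟩ := (ProjLine.exists_coprime_coords x).choose_spec.1
  have h0 : (x.coords 0 : ZMod p) = 0 := congrFun h 0
  have h1 : (x.coords 1 : ZMod p) = 0 := congrFun h 1
  have := congrArg (Int.cast : ℤ → ZMod p) hrs
  simp only [Int.cast_add, Int.cast_mul, Int.cast_one] at this
  change (r : ZMod p) * (x.coords 0 : ZMod p) + s * (x.coords 1 : ZMod p) = 1 at this
  rw [h0, h1] at this
  simp at this

/-- The reduction map `ℙ¹(ℚ) = ℙ¹(ℤ) → ℙ¹(𝔽_p)`. It does not depend on the choice of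
coprime integral coordinates. -/
noncomputable def ProjLine.reduction (p : ℕ) [Fact p.Prime] (x : ProjLine ℚ) :
    ProjLine (ZMod p) :=
  Projectivization.mk (ZMod p) (fun i => (x.coords i : ZMod p)) (x.coords_mod_ne_zero p)

/-- The `K`-points of `X₀ = ℙ¹ × ℙ¹ × ℙ¹`, with homogeneous coordinates `(a₀ : a₁)`,
`(b₀ : b₁)` and `(c₀ : c₁)` on the three factors `a`, `b` and `c`. -/
structure TripleLine (K : Type) [Field K] : Type where
  a : ProjLine K
  b : ProjLine K
  c : ProjLine K

/-- The point lies on the closed subset `V(a₀) ∪ l₁ ∪ l₂` of `ℙ¹ × ℙ¹ × ℙ¹`, where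
`l₁ = V(a₁, b₁)` and `l₂ = V(a₁, c₁)`. -/
def TripleLine.OnBoundary {K : Type} [Field K] (P : TripleLine K) : Prop :=
  P.a.CoordVanishes 0 ∨
    (P.a.CoordVanishes 1 ∧ P.b.CoordVanishes 1) ∨
    (P.a.CoordVanishes 1 ∧ P.c.CoordVanishes 1)

/-- The point lies in the open torus `T₀ = X₀ ∖ V(a₀ a₁ b₀ b₁ c₀ c₁)`, over which the blow-up
`X → X₀` is an isomorphism. -/
def TripleLine.InTorus {K : Type} [Field K] (P : TripleLine K) : Prop :=
  ∀ i : Fin 2, ¬ P.a.CoordVanishes i ∧ ¬ P.b.CoordVanishes i ∧ ¬ P.c.CoordVanishes i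

/-- Reduction modulo `p` of the unique extension of a rational point of `X₀` to an integral point
of the proper model `ℙ¹ × ℙ¹ × ℙ¹` over `ℤ`. -/
noncomputable def TripleLine.reduction (p : ℕ) [Fact p.Prime] (P : TripleLine ℚ) :
    TripleLine (ZMod p) :=
  ⟨P.a.reduction p, P.b.reduction p, P.c.reduction p⟩

/-- The set `𝔘(ℤ)`, as a subset of `X₀(ℚ)`: the model `𝔘` is the complement in
`ℙ¹ × ℙ¹ × ℙ¹` over `ℤ` of the closed subset `V(a₀) ∪ l₁ ∪ l₂`. A section of
`ℙ¹ × ℙ¹ × ℙ¹` over `Spec ℤ` factors through `𝔘` if and only if it sends neither the generic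
point nor any closed point of `Spec ℤ` into that closed subset. -/
def integralPoints : Set (TripleLine ℚ) :=
  {P | ¬ P.OnBoundary ∧ ∀ (p : ℕ) [Fact p.Prime], ¬ (P.reduction p).OnBoundary}

/-- The log anticanonical height `|a₁| max{|b₀|,|b₁|}² max{|c₀|,|c₁|}²`, in coprime integral
coordinates, of a point of `𝔘(ℤ)` in the torus. -/
noncomputable def TripleLine.height (P : TripleLine ℚ) : ℝ :=
  |(P.a.coords 1 : ℝ)| *
    max |(P.b.coords 0 : ℝ)| |(P.b.coords 1 : ℝ)| ^ 2 *
    max |(P.c.coords 0 : ℝ)| |(P.c.coords 1 : ℝ)| ^ 2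

/-- The points of `𝔘(ℤ) ∩ T(ℚ)` of height at most `B`. -/
def pointsOfBoundedHeight (B : ℝ) : Set (TripleLine ℚ) :=
  {P | P ∈ integralPoints ∧ P.InTorus ∧ P.height ≤ B}

/-- The counting function `N(B)`. -/
noncomputable def countingFunction (B : ℝ) : ℕ := (pointsOfBoundedHeight B).ncard

/-- The Euler factor at `p` of the leading constant. -/
noncomputable def eulerFactor (p : Nat.Primes) : ℝ :=
  (1 - 1 / (p : ℝ)) ^ 2 * (1 + 2 / (p : ℝ) - 1 / (p : ℝ) ^ 2 - 1 / (p : ℝ) ^ 3)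

/-- The leading constant `c`. -/
noncomputable def leadingConstant : ℝ := 4 * ∏' p : Nat.Primes, eulerFactor p

/-! A torus point of `integralPoints` is three signs together with positive integers `a = |a₁|`,
`(b₀, b₁)`, `(c₀, c₁)`: integrality forces `|a₀| = 1` and makes `b₁`, `c₁` coprime to `a`. Hence
`N(B)` is eight times the size of `heightTuples B` (`countingFunction_eq`).

For fixed `a`, Möbius inversion shows that the coprime pairs in a box of side `n` with second entry
prime to `a` number `δ(a) n² + O(h(a) n^{3/2})`, with `δ = pairDensity` and `h = invSqrtDivisorSum`
(`abs_card_coprimePairs_sub_le`). With `m`, `n` the two maxima, the height condition reads `m n ≤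
√(B/a)`, and a hyperbola sum (`abs_hyperbola_sum_sub_le`) gives `δ(a)² (B/a) log(B/a) + O(h(a)
B/a)`.

It remains to sum over `a ≤ B`. Since `h` is bounded on average with weight `1/a`, the errors add up
to `O(B log B)`. In the main term, `δ²` is a constant times a divisor sum of small weights, so it
has a mean value `κ = meanSqDensity` and the sum is `κ B (log B)²/2 + O(B log B)`
(`exists_abs_sum_pairDensity_sq_sub_le`). Multiplying by 8 gives `4κ`, and `κ` is the Euler product
(`hasProd_eulerFactor`). The error obtained is `O(B log B)`, without the powers of `log log B`. -/

/-! ### Multiplicative functions supported on squarefree numbers, and their Euler products. -/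

/-- The function supported on squarefree numbers with value `∏ p ∣ n, f p`. -/
noncomputable def sqfreeProd (f : ℕ → ℝ) (n : ℕ) : ℝ :=
  if Squarefree n then ∏ p ∈ n.primeFactors, f p else 0

theorem sqfreeProd_zero (f : ℕ → ℝ) : sqfreeProd f 0 = 0 := by
  simp [sqfreeProd]

theorem sqfreeProd_one (f : ℕ → ℝ) : sqfreeProd f 1 = 1 := by
  simp [sqfreeProd]

theorem sqfreeProd_prime (f : ℕ → ℝ) {p : ℕ} (hp : p.Prime) : sqfreeProd f p = f p := by
  simp [sqfreeProd, hp.prime.squarefree, hp.primeFactors]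

theorem sqfreeProd_mul (f : ℕ → ℝ) {m n : ℕ} (h : m.Coprime n) :
    sqfreeProd f (m * n) = sqfreeProd f m * sqfreeProd f n := by
  unfold sqfreeProd
  rw [h.primeFactors_mul, Finset.prod_union h.disjoint_primeFactors]
  simp only [Nat.squarefree_mul h]
  by_cases hm : Squarefree m <;> by_cases hn : Squarefree n <;> simp [hm, hn]

theorem abs_sqfreeProd (f : ℕ → ℝ) (n : ℕ) :
    |sqfreeProd f n| = sqfreeProd (fun p => |f p|) n := by
  unfold sqfreeProd
  split_ifs
  · rw [Finset.abs_prod]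
  · simp

theorem sqfreeProd_mul_fun (f g : ℕ → ℝ) (n : ℕ) :
    sqfreeProd (fun p => f p * g p) n = sqfreeProd f n * sqfreeProd g n := by
  unfold sqfreeProd
  split_ifs
  · rw [Finset.prod_mul_distrib]
  · simp

/-- A completely multiplicative factor can be pulled out of `sqfreeProd`. -/
theorem sqfreeProd_mul_map (f : ℕ → ℝ) (g : ℕ →* ℝ) (n : ℕ) :
    sqfreeProd (fun p => f p * g p) n = sqfreeProd f n * g n := by
  rw [sqfreeProd_mul_fun]
  unfold sqfreeProd
  split_ifs with h
  · rw [← map_prod, Nat.prod_primeFactors_of_squarefree h]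
  · simp

theorem sqfreeProd_nonneg {f : ℕ → ℝ} (hf : ∀ p, 0 ≤ f p) (n : ℕ) : 0 ≤ sqfreeProd f n := by
  unfold sqfreeProd
  split_ifs
  · exact Finset.prod_nonneg fun p _ => hf p
  · exact le_rfl

/-- Squarefree divisors correspond to sets of prime factors, so the sum is the expansion of the
product. -/
theorem sum_divisors_sqfreeProd (f : ℕ → ℝ) {n : ℕ} (hn : n ≠ 0) :
    ∑ d ∈ n.divisors, sqfreeProd f d = ∏ p ∈ n.primeFactors, (1 + f p) := by
  rw [Finset.prod_one_add]
  unfold sqfreeProd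
  rw [← Finset.sum_filter, Nat.sum_divisors_filter_squarefree hn]
  have : UniqueFactorizationMonoid.normalizedFactors n = n.primeFactorsList := by
    rw [Nat.factors_eq]
  rw [this]
  refine Finset.sum_congr ?_ fun s hs => ?_
  · congr 1
  · have hs' : ∀ p ∈ s, p.Prime := by
      intro p hp
      have := (Finset.mem_powerset.1 hs) hp
      exact Nat.prime_of_mem_primeFactorsList (by simpa using this)
    have : s.val.prod = ∏ p ∈ s, p := Finset.prod_val s
    rw [this, Nat.primeFactors_prod hs']

/-- Every squarefree `n < N` divides the primorial of `N`, so partial sums are at most `∏ (1 + |f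
p|) ≤ exp (∑ |f p|)`. -/
theorem summable_sqfreeProd {f : ℕ → ℝ} (hf : Summable fun n => |f n|) :
    Summable fun n => |sqfreeProd f n| := by
  simp_rw [abs_sqfreeProd]
  set F : ℕ → ℝ := fun p => |f p|
  have hF : ∀ p, 0 ≤ F p := fun p => abs_nonneg _
  refine summable_of_sum_range_le (c := Real.exp (∑' n, F n)) (sqfreeProd_nonneg hF) fun N => ?_
  have hM : primorial N ≠ 0 := (primorial_pos N).ne'
  calc ∑ n ∈ Finset.range N, sqfreeProd F n
      = ∑ n ∈ Finset.range N with Squarefree n, sqfreeProd F n := by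
        rw [Finset.sum_filter]
        refine Finset.sum_congr rfl fun n _ => ?_
        split_ifs with h
        · rfl
        · simp [sqfreeProd, h]
    _ ≤ ∑ n ∈ (primorial N).divisors, sqfreeProd F n := by
        refine Finset.sum_le_sum_of_subset_of_nonneg ?_ fun n _ _ => sqfreeProd_nonneg hF n
        intro n hn
        rw [Finset.mem_filter, Finset.mem_range] at hn
        rw [Nat.mem_divisors]
        refine ⟨?_, hM⟩
        rw [← Nat.prod_primeFactors_of_squarefree hn.2, primorial]
        refine Finset.prod_dvd_prod_of_subset _ _ _ fun p hp => ?_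
        have := Nat.le_of_mem_primeFactors hp
        simp only [Finset.mem_filter, Finset.mem_range]
        exact ⟨by lia, Nat.prime_of_mem_primeFactors hp⟩
    _ = ∏ p ∈ (primorial N).primeFactors, (1 + F p) := sum_divisors_sqfreeProd F hM
    _ ≤ Real.exp (∑ p ∈ (primorial N).primeFactors, F p) := by
        rw [Real.exp_sum]
        exact Finset.prod_le_prod (fun p _ => by linarith [hF p])
          fun p _ => by linarith [Real.add_one_le_exp (F p)]
    _ ≤ Real.exp (∑' n, F n) := Real.exp_le_exp.2 (hf.sum_le_tsum _ fun p _ => hF p)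

theorem hasProd_sqfreeProd {f : ℕ → ℝ} (hf : Summable fun n => |f n|) :
    HasProd (fun p : Nat.Primes => 1 + f p) (∑' n, sqfreeProd f n) := by
  have h := EulerProduct.eulerProduct_hasProd (sqfreeProd_one f) (sqfreeProd_mul f)
    (summable_sqfreeProd hf) (sqfreeProd_zero f)
  suffices e : ∀ p : Nat.Primes, ∑' e, sqfreeProd f ((p : ℕ) ^ e) = 1 + f p by
    simp_rw [e] at h
    exact h
  intro p
  rw [tsum_eq_sum (s := Finset.range 2)]
  · simp [Finset.sum_range_succ, sqfreeProd_one, sqfreeProd_prime f p.2]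
  · intro e he
    have he : 1 < e := by simpa using he
    have : ¬ Squarefree ((p : ℕ) ^ e) := fun h =>  by
      have := Nat.squarefree_pow_iff p.2.ne_one (by lia : e ≠ 0) |>.1 h
      lia
    simp [sqfreeProd, this]

/-! ### Divisor sums, logarithmic sums and a convergent majorant. -/

theorem sum_Ioc_sum_divisors {M : Type*} [AddCommMonoid M] (F : ℕ → ℕ → M) (N : ℕ) :
    ∑ n ∈ Finset.Ioc 0 N, ∑ d ∈ n.divisors, F d (n / d) =
      ∑ d ∈ Finset.Ioc 0 N, ∑ e ∈ Finset.Ioc 0 (N / d), F d e := by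
  rw [Finset.sum_sigma', Finset.sum_sigma']
  refine Finset.sum_bij' (fun x _ => ⟨x.2, x.1 / x.2⟩) (fun x _ => ⟨x.1 * x.2, x.1⟩) ?_ ?_ ?_ ?_ ?_
  · rintro ⟨n, d⟩ h
    simp only [Finset.mem_sigma, Finset.mem_Ioc, Nat.mem_divisors] at h ⊢
    obtain ⟨⟨hn, hN⟩, ⟨e, rfl⟩, -⟩ := h
    have hd : 0 < d := Nat.pos_of_mul_pos_right hn
    have he : 0 < e := Nat.pos_of_mul_pos_left hn
    rw [Nat.mul_div_cancel_left _ hd, Nat.le_div_iff_mul_le hd]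
    exact ⟨⟨hd, le_trans (Nat.le_mul_of_pos_right d he) hN⟩, he, by linarith [mul_comm d e]⟩
  · rintro ⟨d, e⟩ h
    simp only [Finset.mem_sigma, Finset.mem_Ioc, Nat.mem_divisors] at h ⊢
    obtain ⟨⟨hd, hN⟩, he, hle⟩ := h
    rw [Nat.le_div_iff_mul_le hd] at hle
    have : 0 < d * e := Nat.mul_pos hd he
    exact ⟨⟨this, by linarith [mul_comm d e]⟩, dvd_mul_right _ _, this.ne'⟩
  · rintro ⟨n, d⟩ h
    simp only [Finset.mem_sigma, Finset.mem_Ioc, Nat.mem_divisors] at h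
    simp [Nat.mul_div_cancel' h.2.1]
  · rintro ⟨d, e⟩ h
    simp only [Finset.mem_sigma, Finset.mem_Ioc] at h
    simp [Nat.mul_div_cancel_left _ h.1.1]
  · rintro ⟨n, d⟩ h
    rfl

theorem sum_Ioc_floor_sum_divisors {M : Type*} [AddCommMonoid M] (F : ℕ → ℕ → M) (x : ℝ) :
    ∑ n ∈ Finset.Ioc 0 ⌊x⌋₊, ∑ d ∈ n.divisors, F d (n / d) =
      ∑ d ∈ Finset.Ioc 0 ⌊x⌋₊, ∑ e ∈ Finset.Ioc 0 ⌊x / d⌋₊, F d e := by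
  simp_rw [Nat.floor_div_natCast]
  exact sum_Ioc_sum_divisors F _

/-- Comparison with the integral of `log(x/t)/t`, whose antiderivative is `-log(x/t)²/2`; the extra
`log x` is the term `n = 1`. -/
theorem sum_Ioc_log_div_le {x : ℝ} {N : ℕ} (hN : 1 ≤ N) (hx : (N : ℝ) ≤ x) :
    ∑ n ∈ Finset.Ioc 0 N, Real.log (x / n) / n ≤
      Real.log x + Real.log x ^ 2 / 2 - Real.log (x / N) ^ 2 / 2 := by
  induction N, hN using Nat.le_induction with
  | base => simp
  | succ N hN ih =>
    have hN0 : (0 : ℝ) < N := by exact_mod_cast hN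
    push_cast at hx
    have hx0 : 0 < x := by linarith
    have ih := ih (by linarith)
    rw [Finset.sum_Ioc_succ_top (by lia)]
    push_cast
    have h1 : Real.log (x / N) - Real.log (x / (N + 1)) ≥ 1 / (N + 1) := by
      rw [← Real.log_div (by positivity) (by positivity)]
      have : x / N / (x / (N + 1)) = (1 - 1 / ((N : ℝ) + 1))⁻¹ := by
        field_simp
        simp [hN0.ne']
      rw [this, Real.log_inv]
      have h2 : 0 < 1 - 1 / ((N : ℝ) + 1) := by
        have : 1 / ((N : ℝ) + 1) < 1 := by rw [div_lt_one (by positivity)]; linarith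
        linarith
      have := Real.log_le_sub_one_of_pos h2
      linarith
    have h0 : 0 ≤ Real.log (x / (N + 1)) := Real.log_nonneg (by rw [le_div_iff₀] <;> linarith)
    have h3 : 0 ≤ 1 / ((N : ℝ) + 1) := by positivity
    rw [div_eq_mul_one_div (Real.log (x / (N + 1)))]
    nlinarith

theorem le_sum_Ioc_log_div {x : ℝ} {N : ℕ} (hN : 1 ≤ N) (hx : (N : ℝ) ≤ x) :
    Real.log x ^ 2 / 2 - Real.log (x / N) ^ 2 / 2 + Real.log (x / N) / N ≤
    ∑ n ∈ Finset.Ioc 0 N, Real.log (x / n) / n := by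
  induction N, hN using Nat.le_induction with
  | base => simp
  | succ N hN ih =>
    have hN0 : (0 : ℝ) < N := by exact_mod_cast hN
    push_cast at hx
    have hx0 : 0 < x := by linarith
    have ih := ih (by linarith)
    rw [Finset.sum_Ioc_succ_top (by lia)]
    push_cast
    have h1 : Real.log (x / N) - Real.log (x / (N + 1)) ≤ 1 / N := by
      rw [← Real.log_div (by positivity) (by positivity)]
      have : x / N / (x / (N + 1)) = 1 + 1 / (N : ℝ) := by
        field_simp
      rw [this]
      have := Real.log_le_sub_one_of_pos (show 0 < 1 + 1 / (N : ℝ) by positivity)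
      linarith
    have h0 : 0 ≤ Real.log (x / (N + 1)) := Real.log_nonneg (by rw [le_div_iff₀] <;> linarith)
    have h2 : Real.log (x / (N + 1)) ≤ Real.log (x / N) := by
      apply Real.log_le_log (by positivity)
      gcongr
      linarith
    rw [div_eq_mul_one_div (Real.log (x / N))] at ih
    nlinarith

theorem abs_sum_log_div_sub_le {x : ℝ} (hx : 1 ≤ x) :
    |∑ n ∈ Finset.Ioc 0 ⌊x⌋₊, Real.log (x / n) / n - Real.log x ^ 2 / 2| ≤ 1 + Real.log x := by
  have hN : 1 ≤ ⌊x⌋₊ := Nat.one_le_floor_iff x |>.2 hx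
  have hN0 : (1 : ℝ) ≤ ⌊x⌋₊ := by exact_mod_cast hN
  have hNx : (⌊x⌋₊ : ℝ) ≤ x := Nat.floor_le (by linarith)
  have hxN : x < ⌊x⌋₊ + 1 := Nat.lt_floor_add_one x
  have h1 := sum_Ioc_log_div_le hN hNx
  have h2 := le_sum_Ioc_log_div hN hNx
  have h3 : 0 ≤ Real.log (x / ⌊x⌋₊) := Real.log_nonneg (by rw [le_div_iff₀] <;> linarith)
  have h4 : Real.log (x / ⌊x⌋₊) ≤ 1 := by
    have := Real.log_le_sub_one_of_pos (show 0 < x / ⌊x⌋₊ by positivity)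
    have h5 : x / ⌊x⌋₊ ≤ 2 := by rw [div_le_iff₀] <;> linarith
    linarith
  have h5 : 0 ≤ Real.log (x / ⌊x⌋₊) / ⌊x⌋₊ := by positivity
  have h6 : 0 ≤ Real.log x := Real.log_nonneg hx
  rw [abs_le]
  constructor <;> nlinarith

/-- The series `∑ n^{-3/2}` is the common majorant from which the later convergence statements and
error constants are derived. -/
theorem summable_one_div_mul_sqrt : Summable fun n : ℕ => 1 / ((n : ℝ) * √n) := by
  have h := Real.summable_one_div_nat_rpow.2 (show (1 : ℝ) < 3 / 2 by norm_num)
  refine h.congr fun n => ?_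
  rw [show (3 / 2 : ℝ) = 1 + 1 / 2 by norm_num, Real.rpow_add' (by positivity) (by norm_num),
    Real.rpow_one, Real.sqrt_eq_rpow]

/-- The value `ζ(3/2)`. -/
noncomputable def zetaThreeHalves : ℝ := ∑' n : ℕ, 1 / ((n : ℝ) * √n)

theorem zetaThreeHalves_nonneg : 0 ≤ zetaThreeHalves := tsum_nonneg fun n => by positivity

theorem sum_one_div_mul_sqrt_le (s : Finset ℕ) :
    ∑ n ∈ s, 1 / ((n : ℝ) * √n) ≤ zetaThreeHalves :=
  summable_one_div_mul_sqrt.sum_le_tsum _ fun n _ => by positivity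

theorem one_div_sq_le (n : ℕ) : 1 / (n : ℝ) ^ 2 ≤ 1 / ((n : ℝ) * √n) := by
  rcases Nat.eq_zero_or_pos n with rfl | hn
  · simp
  have hn : (1 : ℝ) ≤ n := by exact_mod_cast hn
  have : √(n : ℝ) ≤ n := (Real.sqrt_le_left (by linarith)).2 (by nlinarith)
  have h0 : 0 < √(n : ℝ) := Real.sqrt_pos.2 (by linarith)
  rw [sq]
  gcongr

theorem sum_Ioc_one_div_sqrt_le (n : ℕ) : ∑ m ∈ Finset.Ioc 0 n, 1 / √(m : ℝ) ≤ 2 * √n := by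
  induction n with
  | zero => simp
  | succ n ih =>
    rw [Finset.sum_Ioc_succ_top (by lia)]
    push_cast
    have h0 : 0 ≤ √(n : ℝ) := Real.sqrt_nonneg _
    have h1 : 0 < √((n : ℝ) + 1) := Real.sqrt_pos.2 (by positivity)
    have h2 := Real.sq_sqrt (show 0 ≤ (n : ℝ) by positivity)
    have h3 := Real.sq_sqrt (show 0 ≤ (n : ℝ) + 1 by positivity)
    have : 1 / √((n : ℝ) + 1) ≤ 2 * (√((n : ℝ) + 1) - √(n : ℝ)) := by
      rw [div_le_iff₀ h1]
      nlinarith [sq_nonneg (√((n : ℝ) + 1) - √(n : ℝ))]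
    linarith

/-! ### Partial summation and the hyperbola sum. -/

theorem sum_Ioc_mul_eq_sum_mul_sub (e w : ℕ → ℝ) (n : ℕ) :
    ∑ m ∈ Finset.Ioc 0 n, e m * w m = (∑ m ∈ Finset.Ioc 0 n, e m) * w (n + 1) +
      ∑ k ∈ Finset.Ioc 0 n, (∑ m ∈ Finset.Ioc 0 k, e m) * (w k - w (k + 1)) := by
  induction n with
  | zero => simp
  | succ n ih =>
    rw [Finset.sum_Ioc_succ_top (by lia), ih,
      Finset.sum_Ioc_succ_top (f := fun k => (∑ m ∈ Finset.Ioc 0 k, e m) * (w k - w (k + 1)))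
        (by lia), Finset.sum_Ioc_succ_top (by lia)]
    ring

/-- Abel summation: the differences of `1/k²` are at most `2/k³`, and against partial sums of size
`k^{3/2}` this leaves `∑ k^{-3/2}`. -/
theorem abs_sum_div_sq_le {e : ℕ → ℝ} {K : ℝ}
    (h : ∀ n : ℕ, |∑ m ∈ Finset.Ioc 0 n, e m| ≤ K * (n * √n)) (n : ℕ) :
    |∑ m ∈ Finset.Ioc 0 n, e m / (m : ℝ) ^ 2| ≤ K * (1 + 2 * zetaThreeHalves) := by
  have hK : 0 ≤ K := by
    have := (abs_nonneg _).trans (h 1)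
    simpa using this
  have h1 := sum_Ioc_mul_eq_sum_mul_sub e (fun m => 1 / (m : ℝ) ^ 2) n
  simp only [mul_one_div] at h1
  rw [h1]
  refine (abs_add_le _ _).trans ?_
  have h2 : |(∑ m ∈ Finset.Ioc 0 n, e m) / ((n + 1 : ℕ) : ℝ) ^ 2| ≤ K := by
    rw [abs_div, abs_of_nonneg (by positivity : (0 : ℝ) ≤ ((n + 1 : ℕ) : ℝ) ^ 2),
      div_le_iff₀ (by positivity)]
    refine (h n).trans ?_
    push_cast
    have : √(n : ℝ) ≤ n + 1 := by
      rw [Real.sqrt_le_left (by positivity)]; nlinarith [Nat.cast_nonneg (α := ℝ) n]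
    rw [sq]
    gcongr
    linarith
  have h3 : |∑ k ∈ Finset.Ioc 0 n, (∑ m ∈ Finset.Ioc 0 k, e m) *
      (1 / (k : ℝ) ^ 2 - 1 / ((k + 1 : ℕ) : ℝ) ^ 2)| ≤ K * (2 * zetaThreeHalves) := by
    refine (Finset.abs_sum_le_sum_abs _ _).trans ?_
    calc _ ≤ ∑ k ∈ Finset.Ioc 0 n, K * 2 * (1 / ((k : ℝ) * √k)) := by
          refine Finset.sum_le_sum fun k hk => ?_
          have hk0 : (0 : ℝ) < k := by exact_mod_cast (Finset.mem_Ioc.1 hk).1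
          have hs : 0 < √(k : ℝ) := Real.sqrt_pos.2 hk0
          have hs2 : √(k : ℝ) ^ 2 = k := Real.sq_sqrt hk0.le
          have h4 : 1 / (k : ℝ) ^ 2 - 1 / ((k + 1 : ℕ) : ℝ) ^ 2 ≤ 2 / k ^ 3 := by
            push_cast
            rw [div_sub_div _ _ (by positivity) (by positivity),
              div_le_div_iff₀ (by positivity) (by positivity)]
            have : 0 < (k : ℝ) ^ 2 := by positivity
            have : 0 < (k : ℝ) ^ 3 := by positivity
            nlinarith
          have h5 : 0 ≤ 1 / (k : ℝ) ^ 2 - 1 / ((k + 1 : ℕ) : ℝ) ^ 2 := by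
            rw [sub_nonneg]
            push_cast
            gcongr
            linarith
          rw [abs_mul, abs_of_nonneg h5]
          calc _ ≤ K * (k * √k) * (2 / k ^ 3) := by gcongr; exact h k
            _ = K * 2 * (√k ^ 2 / (k ^ 2 * √k)) := by field_simp
            _ = _ := by rw [hs2]; field_simp
      _ = K * 2 * ∑ k ∈ Finset.Ioc 0 n, (1 / ((k : ℝ) * √k)) := by rw [Finset.mul_sum]
      _ ≤ K * 2 * zetaThreeHalves := by gcongr; exact sum_one_div_mul_sqrt_le _
      _ = _ := by ring
  linarith

theorem sum_Ioc_floor_one_div {y : ℝ} (hy : 1 ≤ y) :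
    |∑ m ∈ Finset.Ioc 0 ⌊y⌋₊, 1 / (m : ℝ) - Real.log y| ≤ 1 := by
  have h1 := log_le_harmonic_floor y (by linarith)
  have h2 := harmonic_floor_le_one_add_log y hy
  have h3 : (harmonic ⌊y⌋₊ : ℝ) = ∑ m ∈ Finset.Ioc 0 ⌊y⌋₊, 1 / (m : ℝ) := by
    rw [harmonic_eq_sum_Icc]
    push_cast
    simp only [one_div]
    rfl
  rw [← h3, abs_le]
  constructor <;> linarith

theorem abs_sq_floor_sub_sq_le {x : ℝ} (hx : 0 ≤ x) :
    |(⌊x⌋₊ : ℝ) ^ 2 - x ^ 2| ≤ 2 * (x * √x) := by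
  have hNx : (⌊x⌋₊ : ℝ) ≤ x := Nat.floor_le hx
  have hxN : x < ⌊x⌋₊ + 1 := Nat.lt_floor_add_one x
  have h0 : (0 : ℝ) ≤ ⌊x⌋₊ := by positivity
  have hs := Real.sq_sqrt hx
  have hs0 := Real.sqrt_nonneg x
  rw [abs_sub_comm, abs_of_nonneg (by nlinarith)]
  rcases lt_or_ge x 1 with h | h
  · have : x ≤ √x := by
      exact Real.le_sqrt_of_sq_le (by nlinarith)
    nlinarith
  · have : 1 ≤ √x := Real.one_le_sqrt.2 h
    nlinarith

/-- If `∑_{m ≤ n} g m` is asymptotic to `δ n²`, then the sum of `g m g n` over `m n ≤ y` is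
asymptotic to `2 δ² y² log y`. -/
theorem abs_hyperbola_sum_sub_le {g : ℕ → ℝ} {δ K y : ℝ} (hg0 : ∀ m, 0 ≤ g m)
    (hg : ∀ m, g m ≤ 2 * m) (hδ0 : 0 ≤ δ) (hδ1 : δ ≤ 1) (hK : 1 ≤ K)
    (hG : ∀ n : ℕ, |∑ m ∈ Finset.Ioc 0 n, g m - δ * (n : ℝ) ^ 2| ≤ K * (n * √n)) (hy : 1 ≤ y) :
    |∑ m ∈ Finset.Ioc 0 ⌊y⌋₊, g m * ∑ n ∈ Finset.Ioc 0 ⌊y / m⌋₊, g n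
      - 2 * δ ^ 2 * y ^ 2 * Real.log y| ≤ (15 + 3 * zetaThreeHalves) * K * y ^ 2 := by
  have hy0 : 0 ≤ y := by linarith
  have hZ := zetaThreeHalves_nonneg
  have hG' : ∀ x : ℝ, 0 ≤ x →
      |∑ n ∈ Finset.Ioc 0 ⌊x⌋₊, g n - δ * x ^ 2| ≤ (K + 2) * (x * √x) := by
    intro x hx
    have h1 := hG ⌊x⌋₊
    have h2 := abs_sq_floor_sub_sq_le hx
    have hNx : (⌊x⌋₊ : ℝ) ≤ x := Nat.floor_le hx
    calc _ = |(∑ n ∈ Finset.Ioc 0 ⌊x⌋₊, g n - δ * (⌊x⌋₊ : ℝ) ^ 2) +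
            δ * ((⌊x⌋₊ : ℝ) ^ 2 - x ^ 2)| := by ring_nf
      _ ≤ K * (⌊x⌋₊ * √⌊x⌋₊) + 1 * (2 * (x * √x)) := by
          refine (abs_add_le _ _).trans ?_
          rw [abs_mul, abs_of_nonneg hδ0]
          gcongr
      _ ≤ K * (x * √x) + 1 * (2 * (x * √x)) := by gcongr
      _ = _ := by ring
  -- Replacing the inner sum by its main term costs `m (y/m)^{3/2}` for each `m`, and `y^{3/2} ∑
  -- m^{-1/2}` is of order `y²`.
  have hA : |∑ m ∈ Finset.Ioc 0 ⌊y⌋₊, g m * ∑ n ∈ Finset.Ioc 0 ⌊y / m⌋₊, g n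
      - ∑ m ∈ Finset.Ioc 0 ⌊y⌋₊, g m * (δ * (y / m) ^ 2)| ≤ (K + 2) * (4 * y ^ 2) := by
    rw [← Finset.sum_sub_distrib]
    refine (Finset.abs_sum_le_sum_abs _ _).trans ?_
    calc _ ≤ ∑ m ∈ Finset.Ioc 0 ⌊y⌋₊, (K + 2) * (2 * (y * √y)) * (1 / √m) := by
          refine Finset.sum_le_sum fun m hm => ?_
          have hm0 : (0 : ℝ) < m := by exact_mod_cast (Finset.mem_Ioc.1 hm).1
          have hs : 0 < √(m : ℝ) := Real.sqrt_pos.2 hm0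
          rw [← mul_sub, abs_mul, abs_of_nonneg (hg0 m)]
          calc _ ≤ (2 * m) * ((K + 2) * (y / m * √(y / m))) :=
                mul_le_mul (hg m) (hG' _ (by positivity)) (abs_nonneg _) (by positivity)
            _ = _ := by
                rw [Real.sqrt_div hy0]
                field_simp
      _ = (K + 2) * (2 * (y * √y)) * ∑ m ∈ Finset.Ioc 0 ⌊y⌋₊, 1 / √(m : ℝ) := by
          rw [Finset.mul_sum]
      _ ≤ (K + 2) * (2 * (y * √y)) * (2 * √y) := by
          gcongr
          refine (sum_Ioc_one_div_sqrt_le _).trans ?_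
          gcongr
          exact Nat.floor_le hy0
      _ = (K + 2) * 4 * y * √y ^ 2 := by ring
      _ = _ := by rw [Real.sq_sqrt hy0]; ring
  have hB : |∑ m ∈ Finset.Ioc 0 ⌊y⌋₊, g m / (m : ℝ) ^ 2 - 2 * δ * Real.log y| ≤
      K * (1 + 2 * zetaThreeHalves) + 2 + zetaThreeHalves := by
    -- Here `2m - 1 = m² - (m-1)²`, so `δ (2m - 1)` has partial sums exactly `δ n²`, and its
    -- quotient by `m²` sums to `2δ log y` up to a bounded amount.
    have h1 := abs_sum_div_sq_le (e := fun m => g m - δ * (2 * m - 1)) (K := K) (by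
      intro n
      convert hG n using 2
      rw [Finset.sum_sub_distrib, ← Finset.mul_sum]
      congr 2
      induction n with
      | zero => simp
      | succ n ih => rw [Finset.sum_Ioc_succ_top (by lia), ih]; push_cast; ring) ⌊y⌋₊
    have h2 := sum_Ioc_floor_one_div hy
    have h3 : ∑ m ∈ Finset.Ioc 0 ⌊y⌋₊, 1 / (m : ℝ) ^ 2 ≤ zetaThreeHalves :=
      (Finset.sum_le_sum fun m _ => one_div_sq_le m).trans (sum_one_div_mul_sqrt_le _)
    have h4 : 0 ≤ ∑ m ∈ Finset.Ioc 0 ⌊y⌋₊, 1 / (m : ℝ) ^ 2 :=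
      Finset.sum_nonneg fun m _ => by positivity
    have h5 : ∑ m ∈ Finset.Ioc 0 ⌊y⌋₊, (g m - δ * (2 * m - 1)) / (m : ℝ) ^ 2 =
        ∑ m ∈ Finset.Ioc 0 ⌊y⌋₊, g m / (m : ℝ) ^ 2 -
          δ * (2 * ∑ m ∈ Finset.Ioc 0 ⌊y⌋₊, 1 / (m : ℝ) -
            ∑ m ∈ Finset.Ioc 0 ⌊y⌋₊, 1 / (m : ℝ) ^ 2) := by
      rw [Finset.mul_sum, ← Finset.sum_sub_distrib, Finset.mul_sum, ← Finset.sum_sub_distrib]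
      refine Finset.sum_congr rfl fun m hm => ?_
      have hm0 : (0 : ℝ) < m := by exact_mod_cast (Finset.mem_Ioc.1 hm).1
      field_simp
    rw [h5] at h1
    rw [abs_le] at h1 h2 ⊢
    constructor <;> nlinarith
  have hC : ∑ m ∈ Finset.Ioc 0 ⌊y⌋₊, g m * (δ * (y / m) ^ 2) =
      δ * y ^ 2 * ∑ m ∈ Finset.Ioc 0 ⌊y⌋₊, g m / (m : ℝ) ^ 2 := by
    rw [Finset.mul_sum]
    refine Finset.sum_congr rfl fun m _ => ?_
    ring
  rw [hC] at hA
  set S := ∑ m ∈ Finset.Ioc 0 ⌊y⌋₊, g m / (m : ℝ) ^ 2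
  set T := ∑ m ∈ Finset.Ioc 0 ⌊y⌋₊, g m * ∑ n ∈ Finset.Ioc 0 ⌊y / m⌋₊, g n
  calc |T - 2 * δ ^ 2 * y ^ 2 * Real.log y|
      = |(T - δ * y ^ 2 * S) + δ * y ^ 2 * (S - 2 * δ * Real.log y)| := by ring_nf
    _ ≤ (K + 2) * (4 * y ^ 2) +
        1 * y ^ 2 * (K * (1 + 2 * zetaThreeHalves) + 2 + zetaThreeHalves) := by
        refine (abs_add_le _ _).trans ?_
        rw [abs_mul, abs_of_nonneg (by positivity : 0 ≤ δ * y ^ 2)]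
        gcongr
    _ ≤ _ := by
        have : 0 ≤ y ^ 2 := by positivity
        have : (K + 2) * 4 + (K * (1 + 2 * zetaThreeHalves) + 2 + zetaThreeHalves) ≤
            (15 + 3 * zetaThreeHalves) * K := by nlinarith
        nlinarith

/-! ### Counting integers and pairs under coprimality conditions. -/

/-- The multiplicative function `n ↦ 1 / n` on the natural numbers. -/
noncomputable def natInvHom : ℕ →* ℝ where
  toFun n := 1 / (n : ℝ)
  map_one' := by simp
  map_mul' m n := by push_cast; rw [one_div_mul_one_div]

theorem natInvHom_apply (n : ℕ) : natInvHom n = 1 / (n : ℝ) := rfl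

theorem abs_sqfreeProd_le_one {f : ℕ → ℝ} (hf : ∀ p, |f p| ≤ 1) (n : ℕ) :
    |sqfreeProd f n| ≤ 1 := by
  unfold sqfreeProd
  split_ifs
  · rw [Finset.abs_prod]
    exact Finset.prod_le_one (fun p _ => abs_nonneg _) fun p _ => hf p
  · simp

/-- `sqfreeProd (fun _ => -1)` is the Möbius function. -/
theorem sum_divisors_sqfreeProd_neg_one {n : ℕ} (hn : n ≠ 0) :
    ∑ d ∈ n.divisors, sqfreeProd (fun _ => -1) d = if n = 1 then 1 else 0 := by
  rw [sum_divisors_sqfreeProd _ hn]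
  split_ifs with h
  · simp [h]
  · obtain ⟨p, hp, hpn⟩ := Nat.exists_prime_and_dvd h
    exact Finset.prod_eq_zero (i := p) (by simp [hp, hpn, hn]) (by simp)

theorem ite_coprime_eq_sum {m n : ℕ} (hm : m ≠ 0) :
    (if m.Coprime n then 1 else 0 : ℝ) =
      ∑ d ∈ m.divisors with d ∣ n, sqfreeProd (fun _ => -1) d := by
  have h := sum_divisors_sqfreeProd_neg_one (Nat.gcd_ne_zero_left (n := n) hm)
  have h' : (m.gcd n).divisors = m.divisors.filter (· ∣ n) := by
    ext d
    simp [Nat.dvd_gcd_iff, hm]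
  rw [← h', h]

theorem sqfreeProd_ite_dvd (a n : ℕ) :
    sqfreeProd (fun p => if p ∣ a then 0 else -1) n =
      if n.Coprime a then sqfreeProd (fun _ => -1) n else 0 := by
  unfold sqfreeProd
  by_cases hn : Squarefree n
  · simp only [hn, if_true]
    split_ifs with h
    · refine Finset.prod_congr rfl fun p hp => ?_
      have hp' := Nat.prime_of_mem_primeFactors hp
      rw [if_neg]
      intro hpa
      exact hp'.one_lt.ne' (Nat.eq_one_of_dvd_coprimes h (Nat.dvd_of_mem_primeFactors hp) hpa)
    · obtain ⟨p, hp, h1, h2⟩ := Nat.Prime.not_coprime_iff_dvd.1 h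
      exact Finset.prod_eq_zero (i := p) (by simp [hp, h1, hn.ne_zero]) (by simp [h2])
  · simp [hn]

/-- The sum of `1 / √d` over the divisors `d` of `a`. -/
noncomputable def invSqrtDivisorSum (a : ℕ) : ℝ := ∑ d ∈ a.divisors, 1 / √(d : ℝ)

theorem one_le_invSqrtDivisorSum {a : ℕ} (ha : a ≠ 0) : 1 ≤ invSqrtDivisorSum a := by
  have := Finset.single_le_sum (f := fun d : ℕ => 1 / √(d : ℝ)) (fun d _ => by positivity)
    (Nat.one_mem_divisors.2 ha)
  simpa [invSqrtDivisorSum] using this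

/-- Unlike the bound 1, the bound `√x` decays as `x → 0`. Applied to `n/e` it makes sums over all
`e` converge; applied to `x/d` with `d ∣ a` it yields `invSqrtDivisorSum a`, which stays bounded on
average, rather than a number of divisors, which would cost a logarithm. -/
theorem abs_floor_sub_le_sqrt {x : ℝ} (hx : 0 ≤ x) : |(⌊x⌋₊ : ℝ) - x| ≤ √x := by
  have hNx : (⌊x⌋₊ : ℝ) ≤ x := Nat.floor_le hx
  have hxN : x < ⌊x⌋₊ + 1 := Nat.lt_floor_add_one x
  have h0 : (0 : ℝ) ≤ ⌊x⌋₊ := by positivity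
  rw [abs_sub_comm, abs_of_nonneg (by linarith)]
  rcases lt_or_ge x 1 with h | h
  · have : x ≤ √x := Real.le_sqrt_of_sq_le (by nlinarith)
    linarith
  · have : 1 ≤ √x := Real.one_le_sqrt.2 h
    linarith

/-- The number of positive integers up to `n` that are coprime to `a`. -/
def coprimeCount (a n : ℕ) : ℕ := ((Finset.Ioc 0 n).filter fun b => b.Coprime a).card

theorem coprimeCount_eq_sum {a : ℕ} (ha : a ≠ 0) (n : ℕ) :
    (coprimeCount a n : ℝ) = ∑ d ∈ a.divisors, sqfreeProd (fun _ => -1) d * (n / d : ℕ) := by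
  rw [coprimeCount, Finset.card_filter]
  push_cast
  have : ∀ b ∈ Finset.Ioc 0 n, (if b.Coprime a then 1 else 0 : ℝ) =
      ∑ d ∈ a.divisors, if d ∣ b then sqfreeProd (fun _ => -1) d else 0 := by
    intro b _
    rw [← Finset.sum_filter, ← ite_coprime_eq_sum ha]
    simp only [Nat.coprime_comm]
  rw [Finset.sum_congr rfl this, Finset.sum_comm]
  refine Finset.sum_congr rfl fun d _ => ?_
  rw [← Finset.sum_filter, Finset.sum_const, Nat.Ioc_filter_dvd_card_eq_div, nsmul_eq_mul, mul_comm]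

theorem prod_one_sub_inv_eq_sum {a : ℕ} (ha : a ≠ 0) :
    ∏ p ∈ a.primeFactors, (1 - 1 / (p : ℝ)) =
      ∑ d ∈ a.divisors, sqfreeProd (fun _ => -1) d * (1 / d) := by
  have h := sum_divisors_sqfreeProd (fun p => -1 * natInvHom p) ha
  simp_rw [sqfreeProd_mul_map (fun _ => -1), natInvHom_apply] at h
  rw [h]
  refine Finset.prod_congr rfl fun p _ => ?_
  ring

theorem abs_coprimeCount_floor_sub_le {a : ℕ} (ha : a ≠ 0) {x : ℝ} (hx : 0 ≤ x) :
    |(coprimeCount a ⌊x⌋₊ : ℝ) - x * ∏ p ∈ a.primeFactors, (1 - 1 / (p : ℝ))| ≤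
      invSqrtDivisorSum a * √x := by
  rw [coprimeCount_eq_sum ha, prod_one_sub_inv_eq_sum ha, Finset.mul_sum,
    ← Finset.sum_sub_distrib, invSqrtDivisorSum, Finset.sum_mul]
  refine (Finset.abs_sum_le_sum_abs _ _).trans (Finset.sum_le_sum fun d _ => ?_)
  rw [← Nat.floor_div_natCast]
  calc _ = |sqfreeProd (fun _ => -1) d| * |(⌊x / d⌋₊ : ℝ) - x / d| := by
        rw [← abs_mul]; ring_nf
    _ ≤ 1 * √(x / d) := by
        gcongr
        · exact abs_sqfreeProd_le_one (by simp) d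
        · exact abs_floor_sub_le_sqrt (by positivity)
    _ = _ := by rw [Real.sqrt_div hx]; ring

theorem prod_one_sub_inv_nonneg (a : ℕ) : 0 ≤ ∏ p ∈ a.primeFactors, (1 - 1 / (p : ℝ)) := by
  refine Finset.prod_nonneg fun p hp => ?_
  have : (1 : ℝ) ≤ p := by exact_mod_cast (Nat.prime_of_mem_primeFactors hp).one_le
  rw [sub_nonneg, div_le_one (by linarith)]
  exact this

theorem prod_one_sub_inv_le_one (a : ℕ) : ∏ p ∈ a.primeFactors, (1 - 1 / (p : ℝ)) ≤ 1 := by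
  refine Finset.prod_le_one (fun p hp => ?_) fun p hp => ?_
  · have : (1 : ℝ) ≤ p := by exact_mod_cast (Nat.prime_of_mem_primeFactors hp).one_le
    rw [sub_nonneg, div_le_one (by linarith)]
    exact this
  · have : 0 ≤ 1 / (p : ℝ) := by positivity
    linarith

theorem abs_floor_mul_coprimeCount_sub_le {a : ℕ} (ha : a ≠ 0) {x : ℝ} (hx : 0 ≤ x) :
    |(⌊x⌋₊ : ℝ) * coprimeCount a ⌊x⌋₊ - x ^ 2 * ∏ p ∈ a.primeFactors, (1 - 1 / (p : ℝ))| ≤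
      2 * invSqrtDivisorSum a * (x * √x) := by
  have h1 := abs_coprimeCount_floor_sub_le ha hx
  have h2 := abs_floor_sub_le_sqrt hx
  have h3 := one_le_invSqrtDivisorSum ha
  have h4 := prod_one_sub_inv_nonneg a
  have h5 := prod_one_sub_inv_le_one a
  set φ := ∏ p ∈ a.primeFactors, (1 - 1 / (p : ℝ))
  calc _ = |(⌊x⌋₊ : ℝ) * (coprimeCount a ⌊x⌋₊ - x * φ) + x * φ * (⌊x⌋₊ - x)| := by ring_nf
    _ ≤ x * (invSqrtDivisorSum a * √x) + x * 1 * √x := by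
        refine (abs_add_le _ _).trans ?_
        rw [abs_mul, abs_mul, abs_of_nonneg (by positivity : 0 ≤ x * φ),
          abs_of_nonneg (by positivity : (0 : ℝ) ≤ ⌊x⌋₊)]
        gcongr
        exact Nat.floor_le hx
    _ ≤ _ := by
        have : 0 ≤ x * √x := by positivity
        nlinarith

/-- The coprime pairs of positive integers up to `n` whose second entry is coprime to `a`. -/
def coprimePairs (a n : ℕ) : Finset (ℕ × ℕ) :=
  (Finset.Ioc 0 n ×ˢ Finset.Ioc 0 n).filter fun b => b.1.Coprime b.2 ∧ b.2.Coprime a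

theorem card_filter_dvd_coprime (a n : ℕ) {e : ℕ} (he : e ≠ 0) :
    ((Finset.Ioc 0 n).filter fun b => b.Coprime a ∧ e ∣ b).card =
      if e.Coprime a then coprimeCount a (n / e) else 0 := by
  split_ifs with h
  · rw [coprimeCount, ← Finset.card_image_of_injective
      (f := fun b => e * b) (s := (Finset.Ioc 0 (n / e)).filter fun b => b.Coprime a)
      (mul_right_injective₀ he)]
    congr 1
    ext b
    simp only [Finset.mem_filter, Finset.mem_Ioc, Finset.mem_image]
    constructor
    · rintro ⟨⟨h0, hn⟩, hc, c, rfl⟩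
      refine ⟨c, ⟨⟨Nat.pos_of_mul_pos_left h0, ?_⟩, hc.coprime_mul_left⟩, rfl⟩
      rw [Nat.le_div_iff_mul_le (Nat.pos_of_ne_zero he), mul_comm]
      exact hn
    · rintro ⟨c, ⟨⟨h0, hn⟩, hc⟩, rfl⟩
      rw [Nat.le_div_iff_mul_le (Nat.pos_of_ne_zero he), mul_comm] at hn
      exact ⟨⟨Nat.mul_pos (Nat.pos_of_ne_zero he) h0, hn⟩, Nat.Coprime.mul_left h hc,
        dvd_mul_right _ _⟩
  · rw [Finset.card_eq_zero, Finset.filter_eq_empty_iff]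
    rintro b _ ⟨hc, hd⟩
    exact h (hc.coprime_dvd_left hd)

/-- Möbius inversion over the common divisors `e` of the two entries; the second entry being prime
to `a` forces `e` to be prime to `a`. -/
theorem card_coprimePairs_eq_sum (a n : ℕ) :
    ((coprimePairs a n).card : ℝ) = ∑ e ∈ Finset.Ioc 0 n,
      sqfreeProd (fun p => if p ∣ a then 0 else -1) e *
        ((n / e : ℕ) * coprimeCount a (n / e)) := by
  rw [coprimePairs, Finset.card_filter, Finset.sum_product]
  push_cast
  have h1 : ∀ b ∈ Finset.Ioc 0 n, ∀ c ∈ Finset.Ioc 0 n,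
      (if b.Coprime c ∧ c.Coprime a then 1 else 0 : ℝ) =
      ∑ e ∈ Finset.Ioc 0 n, sqfreeProd (fun _ => -1) e *
        ((if e ∣ b then 1 else 0) * (if c.Coprime a ∧ e ∣ c then 1 else 0)) := by
    intro b hb c hc
    rw [Finset.mem_Ioc] at hb hc
    by_cases hca : c.Coprime a
    · have h2 : ∀ e, (if c.Coprime a ∧ e ∣ c then 1 else 0 : ℝ) = if e ∣ c then 1 else 0 :=
        fun e => if_congr (and_iff_right hca) rfl rfl
      rw [if_congr (and_iff_left hca) rfl rfl]
      simp_rw [h2]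
      rw [ite_coprime_eq_sum (by lia : b ≠ 0), Finset.sum_filter]
      have hsub : b.divisors ⊆ Finset.Ioc 0 n := by
        intro d hd
        have h2 := Nat.pos_of_mem_divisors hd
        have h3 := Nat.divisor_le hd
        rw [Finset.mem_Ioc]
        lia
      rw [← Finset.sum_subset hsub]
      · refine Finset.sum_congr rfl fun d hd => ?_
        simp [Nat.dvd_of_mem_divisors hd]
      · intro d _ hd
        have : ¬ d ∣ b := fun h => hd (Nat.mem_divisors.2 ⟨h, by lia⟩)
        simp [this]
    · simp [hca]
  rw [Finset.sum_congr rfl fun b hb => Finset.sum_congr rfl (h1 b hb)]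
  simp_rw [fun b : ℕ => Finset.sum_comm (s := Finset.Ioc 0 n) (t := Finset.Ioc 0 n)
    (f := fun c e => sqfreeProd (fun _ => -1) e *
        ((if e ∣ b then 1 else 0) * (if c.Coprime a ∧ e ∣ c then 1 else 0 : ℝ)))]
  rw [Finset.sum_comm]
  refine Finset.sum_congr rfl fun e he => ?_
  simp_rw [← Finset.mul_sum]
  rw [← Finset.sum_mul]
  simp_rw [Finset.sum_boole, Nat.Ioc_filter_dvd_card_eq_div]
  rw [card_filter_dvd_coprime a n (Finset.mem_Ioc.1 he).1.ne', sqfreeProd_ite_dvd]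
  split_ifs <;> simp

/-- The density of the pairs counted by `coprimePairs a`. -/
noncomputable def pairDensity (a : ℕ) : ℝ :=
  (∏ p ∈ a.primeFactors, (1 - 1 / (p : ℝ))) *
    ∑' e : ℕ, sqfreeProd (fun p => (if p ∣ a then 0 else -1) * (natInvHom ^ 2) p) e

theorem natInvHom_sq_apply (n : ℕ) : (natInvHom ^ 2) n = 1 / (n : ℝ) ^ 2 := by
  simp [natInvHom_apply]

theorem summable_mul_natInvHom_sq {f : ℕ → ℝ} (hf : ∀ p, |f p| ≤ 1) :
    Summable fun n => |f n * (natInvHom ^ 2) n| := by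
  refine Summable.of_nonneg_of_le (fun _ => abs_nonneg _) (fun n => ?_) summable_one_div_mul_sqrt
  rw [abs_mul, natInvHom_sq_apply, abs_of_nonneg (by positivity : 0 ≤ 1 / (n : ℝ) ^ 2)]
  calc _ ≤ 1 * (1 / (n : ℝ) ^ 2) := by gcongr; exact hf n
    _ ≤ _ := by rw [one_mul]; exact one_div_sq_le n

/-- The Möbius sum is completed to all `e`. Terms with `e > n` count nothing, yet the error bound `2
h(a) (n/e)^{3/2}`, with `h(a)` for `invSqrtDivisorSum a`, still holds there, and it sums to a
multiple of `zetaThreeHalves`. -/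
theorem abs_card_coprimePairs_sub_le {a : ℕ} (ha : a ≠ 0) (n : ℕ) :
    |((coprimePairs a n).card : ℝ) - pairDensity a * (n : ℝ) ^ 2| ≤
      2 * zetaThreeHalves * invSqrtDivisorSum a * (n * √n) := by
  set f : ℕ → ℝ := fun p => if p ∣ a then 0 else -1 with hf
  have hf1 : ∀ p, |f p| ≤ 1 := by
    intro p
    simp only [hf]
    split_ifs <;> simp
  set φ := ∏ p ∈ a.primeFactors, (1 - 1 / (p : ℝ)) with hφ
  have hs1 : HasSum (fun e : ℕ => sqfreeProd f e * ((n / e : ℕ) * coprimeCount a (n / e)))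
      ((coprimePairs a n).card : ℝ) := by
    rw [card_coprimePairs_eq_sum]
    refine hasSum_sum_of_ne_finset_zero fun e he => ?_
    rw [Finset.mem_Ioc] at he
    rcases Nat.eq_zero_or_pos e with rfl | h0
    · simp
    · simp [Nat.div_eq_of_lt (by lia : n < e)]
  have hs2 : HasSum (fun e : ℕ => sqfreeProd f e * (((n : ℝ) / e) ^ 2 * φ))
      (pairDensity a * (n : ℝ) ^ 2) := by
    have := (summable_sqfreeProd (summable_mul_natInvHom_sq hf1)).of_abs.hasSum.mul_left
      (φ * (n : ℝ) ^ 2)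
    have key : ∀ e, sqfreeProd f e * (((n : ℝ) / e) ^ 2 * φ) =
        φ * (n : ℝ) ^ 2 * sqfreeProd (fun p => f p * (natInvHom ^ 2) p) e := by
      intro e
      rw [sqfreeProd_mul_map, natInvHom_sq_apply]
      ring
    simp_rw [key]
    have key2 : pairDensity a * (n : ℝ) ^ 2 =
        φ * (n : ℝ) ^ 2 * ∑' e, sqfreeProd (fun p => f p * (natInvHom ^ 2) p) e := by
      unfold pairDensity
      ring
    rw [key2]
    exact this
  have hs3 := hs1.sub hs2
  have hs4 : HasSum (fun e : ℕ => 2 * invSqrtDivisorSum a * (n * √n) * (1 / ((e : ℝ) * √e)))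
      (2 * invSqrtDivisorSum a * (n * √n) * zetaThreeHalves) :=
    summable_one_div_mul_sqrt.hasSum.mul_left _
  have h := tsum_of_norm_bounded hs4
    (f := fun e : ℕ => sqfreeProd f e * ((n / e : ℕ) * coprimeCount a (n / e)) -
      sqfreeProd f e * (((n : ℝ) / e) ^ 2 * φ)) (by
    intro e
    rw [Real.norm_eq_abs, ← mul_sub, abs_mul]
    have h1 := abs_floor_mul_coprimeCount_sub_le ha (x := (n : ℝ) / e) (by positivity)
    rw [Nat.floor_div_eq_div] at h1
    calc _ ≤ 1 * (2 * invSqrtDivisorSum a * ((n : ℝ) / e * √((n : ℝ) / e))) :=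
          mul_le_mul (abs_sqfreeProd_le_one hf1 e) h1 (abs_nonneg _) zero_le_one
      _ = _ := by
          rw [Real.sqrt_div (by positivity)]
          ring)
  rw [hs3.tsum_eq] at h
  refine h.trans (le_of_eq ?_)
  ring

/-- The number of pairs in `coprimePairs a m` with maximum equal to `m`. -/
def maxPairCount (a m : ℕ) : ℕ := ((coprimePairs a m).filter fun b => max b.1 b.2 = m).card

theorem filter_coprimePairs_max (a : ℕ) {m n : ℕ} (h : m ≤ n) :
    ((coprimePairs a n).filter fun b => max b.1 b.2 = m) =
      (coprimePairs a m).filter fun b => max b.1 b.2 = m := by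
  ext b
  simp only [coprimePairs, Finset.mem_filter, Finset.mem_product, Finset.mem_Ioc]
  constructor
  · rintro ⟨⟨h1, h2⟩, h3⟩
    refine ⟨⟨?_, h2⟩, h3⟩
    lia
  · rintro ⟨⟨h1, h2⟩, h3⟩
    refine ⟨⟨?_, h2⟩, h3⟩
    lia

theorem sum_coprimePairs_max {M : Type*} [AddCommMonoid M] (a n : ℕ) (F : ℕ → M) :
    ∑ b ∈ coprimePairs a n, F (max b.1 b.2) = ∑ m ∈ Finset.Ioc 0 n, maxPairCount a m • F m := by
  rw [← Finset.sum_fiberwise_of_maps_to (s := coprimePairs a n) (t := Finset.Ioc 0 n)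
    (g := fun b => max b.1 b.2)]
  · refine Finset.sum_congr rfl fun m hm => ?_
    rw [filter_coprimePairs_max a (Finset.mem_Ioc.1 hm).2, maxPairCount, ← Finset.sum_const]
    exact Finset.sum_congr rfl fun b hb => by rw [(Finset.mem_filter.1 hb).2]
  · intro b hb
    simp only [coprimePairs, Finset.mem_filter, Finset.mem_product, Finset.mem_Ioc] at hb ⊢
    lia

theorem sum_maxPairCount (a n : ℕ) :
    ∑ m ∈ Finset.Ioc 0 n, maxPairCount a m = (coprimePairs a n).card := by
  have := sum_coprimePairs_max a n (fun _ => 1)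
  simpa using this.symm

/-- A pair with maximum `m` lies on one of two sides of a square, each holding `m` points. -/
theorem maxPairCount_le (a m : ℕ) : maxPairCount a m ≤ 2 * m := by
  have : ((coprimePairs a m).filter fun b => max b.1 b.2 = m) ⊆
      ({m} ×ˢ Finset.Ioc 0 m) ∪ (Finset.Ioc 0 m ×ˢ {m}) := by
    intro b hb
    simp only [coprimePairs, Finset.mem_filter, Finset.mem_product, Finset.mem_Ioc,
      Finset.mem_union, Finset.mem_singleton] at hb ⊢
    lia
  refine (Finset.card_le_card this).trans ((Finset.card_union_le _ _).trans ?_)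
  simp
  lia

/-! ### The pair density as an Euler product. -/

/-- The product of `1 - 1 / p ^ 2` over all primes. -/
noncomputable def coprimeDensity : ℝ := ∑' e : ℕ, sqfreeProd (fun p => -1 * (natInvHom ^ 2) p) e

theorem hasProd_coprimeDensity :
    HasProd (fun p : Nat.Primes => 1 - 1 / (p : ℝ) ^ 2) coprimeDensity := by
  have := hasProd_sqfreeProd (summable_mul_natInvHom_sq (f := fun _ => -1) (by simp))
  have key : ∀ p : Nat.Primes, 1 + -1 * (natInvHom ^ 2) p = 1 - 1 / (p : ℝ) ^ 2 := by
    intro p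
    rw [natInvHom_sq_apply]
    ring
  simp_rw [key] at this
  exact this

theorem prime_one_div_sq (p : ℕ) (hp : p.Prime) : 1 / (p : ℝ) ^ 2 < 1 ∧ 0 < 1 / (p : ℝ) ^ 2 := by
  have : (1 : ℝ) < p := by exact_mod_cast hp.one_lt
  refine ⟨?_, by positivity⟩
  rw [div_lt_one (by positivity)]
  nlinarith

theorem coprimeDensity_nonneg : 0 ≤ coprimeDensity :=
  ge_of_tendsto' hasProd_coprimeDensity fun s =>
    Finset.prod_nonneg fun p _ => by linarith [prime_one_div_sq p p.2]

theorem coprimeDensity_le_one : coprimeDensity ≤ 1 :=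
  le_of_tendsto' hasProd_coprimeDensity fun s =>
    Finset.prod_le_one (fun p _ => by linarith [prime_one_div_sq p p.2])
      fun p _ => by linarith [prime_one_div_sq p p.2]

/-- At primes dividing `a` the density has the factor `1 - 1/p`, which `1 + 1/p` completes to `1 -
1/p²`; at the others it already has the factor `1 - 1/p²`. -/
theorem pairDensity_mul_prod {a : ℕ} (ha : a ≠ 0) :
    pairDensity a * ∏ p ∈ a.primeFactors, (1 + 1 / (p : ℝ)) = coprimeDensity := by
  have h1 := hasProd_sqfreeProd (summable_mul_natInvHom_sq
    (f := fun p => if p ∣ a then 0 else -1) (fun p => by split_ifs <;> simp))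
  have h2 : HasProd (fun p : Nat.Primes => if (p : ℕ) ∣ a then 1 - 1 / (p : ℝ) ^ 2 else 1)
      (∏ p ∈ a.primeFactors, (1 - 1 / (p : ℝ) ^ 2)) := by
    have hinj : Set.InjOn (fun p : Nat.Primes => (p : ℕ))
        ((fun p : Nat.Primes => (p : ℕ)) ⁻¹' a.primeFactors) := fun p _ q _ h => Subtype.ext h
    have h3 := hasProd_prod_of_ne_finset_one (L := SummationFilter.unconditional Nat.Primes)
      (s := a.primeFactors.preimage (fun p : Nat.Primes => (p : ℕ)) hinj)
      (f := fun p : Nat.Primes => if (p : ℕ) ∣ a then 1 - 1 / (p : ℝ) ^ 2 else 1) (by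
        intro p hp
        rw [if_neg]
        intro hpa
        exact hp (Finset.mem_preimage.2 (Nat.mem_primeFactors.2 ⟨p.2, hpa, ha⟩)))
    rw [Finset.prod_preimage (fun p : Nat.Primes => (p : ℕ)) _ hinj
      (fun p : ℕ => if p ∣ a then 1 - 1 / (p : ℝ) ^ 2 else 1)
      fun p hp h => absurd ⟨⟨p, Nat.prime_of_mem_primeFactors hp⟩, rfl⟩ h] at h3
    rwa [Finset.prod_congr rfl fun p hp => if_pos (Nat.dvd_of_mem_primeFactors hp)] at h3
  have h4 := h1.mul h2
  have key : ∀ p : Nat.Primes, (1 + (if (p : ℕ) ∣ a then 0 else -1) * (natInvHom ^ 2) p) *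
      (if (p : ℕ) ∣ a then 1 - 1 / (p : ℝ) ^ 2 else 1) = 1 - 1 / (p : ℝ) ^ 2 := by
    intro p
    rw [natInvHom_sq_apply]
    split_ifs <;> ring
  simp_rw [key] at h4
  rw [← h4.unique hasProd_coprimeDensity, pairDensity, mul_right_comm, mul_comm,
    ← Finset.prod_mul_distrib]
  congr 1
  refine Finset.prod_congr rfl fun p hp => ?_
  ring

theorem one_le_prod_one_add_inv (a : ℕ) : 1 ≤ ∏ p ∈ a.primeFactors, (1 + 1 / (p : ℝ)) :=
  Finset.one_le_prod fun p _ => by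
    have : 0 ≤ 1 / (p : ℝ) := by positivity
    linarith

theorem pairDensity_eq {a : ℕ} (ha : a ≠ 0) :
    pairDensity a = coprimeDensity * ∏ p ∈ a.primeFactors, (1 + 1 / (p : ℝ))⁻¹ := by
  rw [← pairDensity_mul_prod ha, Finset.prod_inv_distrib, mul_inv_cancel_right₀]
  linarith [one_le_prod_one_add_inv a]

theorem pairDensity_nonneg {a : ℕ} (ha : a ≠ 0) : 0 ≤ pairDensity a := by
  rw [pairDensity_eq ha]
  exact mul_nonneg coprimeDensity_nonneg (Finset.prod_nonneg fun p _ => by positivity)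

theorem pairDensity_le_one {a : ℕ} (ha : a ≠ 0) : pairDensity a ≤ 1 := by
  have h1 := pairDensity_mul_prod ha
  have h2 := one_le_prod_one_add_inv a
  have h3 := pairDensity_nonneg ha
  have h4 := coprimeDensity_le_one
  nlinarith

theorem abs_sum_maxPairCount_sub_le {a : ℕ} (ha : a ≠ 0) {y : ℝ} (hy : 1 ≤ y) :
    |∑ m ∈ Finset.Ioc 0 ⌊y⌋₊, (maxPairCount a m : ℝ) * (coprimePairs a ⌊y / m⌋₊).card
      - 2 * pairDensity a ^ 2 * y ^ 2 * Real.log y| ≤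
      (15 + 3 * zetaThreeHalves) * ((1 + 2 * zetaThreeHalves) * invSqrtDivisorSum a) * y ^ 2 := by
  have hZ := zetaThreeHalves_nonneg
  have hh := one_le_invSqrtDivisorSum ha
  have hsum : ∀ n : ℕ,
      ∑ m ∈ Finset.Ioc 0 n, (maxPairCount a m : ℝ) = (coprimePairs a n).card := by
    intro n
    rw [← sum_maxPairCount]
    push_cast
    rfl
  have h := abs_hyperbola_sum_sub_le (g := fun m => (maxPairCount a m : ℝ)) (y := y)
    (fun m => by positivity) (fun m => by exact_mod_cast maxPairCount_le a m)
    (pairDensity_nonneg ha) (pairDensity_le_one ha)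
    (K := (1 + 2 * zetaThreeHalves) * invSqrtDivisorSum a) (by nlinarith) (by
      intro n
      rw [hsum]
      refine (abs_card_coprimePairs_sub_le ha n).trans ?_
      gcongr
      linarith) hy
  simp_rw [hsum] at h
  exact h

/-! ### Counting the tuples of bounded height. -/

theorem card_filter_coprimePairs_max_le (a : ℕ) {k n : ℕ} (h : k ≤ n) :
    ((coprimePairs a n).filter fun b => max b.1 b.2 ≤ k) = coprimePairs a k := by
  ext b
  simp only [coprimePairs, Finset.mem_filter, Finset.mem_product, Finset.mem_Ioc]
  constructor
  · rintro ⟨⟨h1, h2⟩, h3⟩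
    refine ⟨?_, h2⟩
    lia
  · rintro ⟨h1, h2⟩
    refine ⟨⟨?_, h2⟩, ?_⟩ <;> lia

/-- The tuples `(a, (b₀, b₁), (c₀, c₁))` of positive integers with `(b₀, b₁)` and `(c₀, c₁)` in
`coprimePairs a` and `a max(b₀, b₁)² max(c₀, c₁)² ≤ B`. -/
noncomputable def heightTuples (B : ℝ) : Finset ((_ : ℕ) × ((ℕ × ℕ) × (ℕ × ℕ))) :=
  (Finset.Ioc 0 ⌊B⌋₊).sigma fun a =>
    (coprimePairs a ⌊B⌋₊ ×ˢ coprimePairs a ⌊B⌋₊).filter fun t =>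
      (a : ℝ) * (max t.1.1 t.1.2 : ℕ) ^ 2 * (max t.2.1 t.2.2 : ℕ) ^ 2 ≤ B

theorem height_le_iff {B : ℝ} (hB : 0 ≤ B) {a m n : ℕ} (ha : 0 < a) (hm : 0 < m) :
    (a : ℝ) * (m : ℝ) ^ 2 * (n : ℝ) ^ 2 ≤ B ↔ n ≤ ⌊√(B / a) / m⌋₊ := by
  have ha' : (0 : ℝ) < a := by exact_mod_cast ha
  have hm' : (0 : ℝ) < m := by exact_mod_cast hm
  rw [Nat.le_floor_iff (by positivity), le_div_iff₀ hm', Real.le_sqrt (by positivity),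
    le_div_iff₀ ha']
  · ring_nf
  · exact div_nonneg hB ha'.le

theorem card_heightTuples {B : ℝ} (hB : 1 ≤ B) :
    ((heightTuples B).card : ℝ) = ∑ a ∈ Finset.Ioc 0 ⌊B⌋₊, ∑ m ∈ Finset.Ioc 0 ⌊√(B / a)⌋₊,
      (maxPairCount a m : ℝ) * (coprimePairs a ⌊√(B / a) / m⌋₊).card := by
  rw [heightTuples, Finset.card_sigma, Nat.cast_sum]
  refine Finset.sum_congr rfl fun a ha => ?_
  have ha0 := (Finset.mem_Ioc.1 ha).1
  have ha1 : (1 : ℝ) ≤ a := by exact_mod_cast ha0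
  set y := √(B / a) with hy
  have hyB : y ≤ B := by
    rw [hy, Real.sqrt_le_left (by linarith), div_le_iff₀ (by linarith)]
    have : 0 ≤ B ^ 2 := by positivity
    nlinarith
  have hy0 : 0 ≤ y := Real.sqrt_nonneg _
  have h1 : ∀ b ∈ coprimePairs a ⌊B⌋₊, (∑ c ∈ coprimePairs a ⌊B⌋₊,
      if (a : ℝ) * (max b.1 b.2 : ℕ) ^ 2 * (max c.1 c.2 : ℕ) ^ 2 ≤ B then 1 else 0) =
      (coprimePairs a ⌊y / (max b.1 b.2 : ℕ)⌋₊).card := by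
    intro b hb
    have hm : 0 < max b.1 b.2 := by
      simp only [coprimePairs, Finset.mem_filter, Finset.mem_product, Finset.mem_Ioc] at hb
      lia
    have hm1 : (1 : ℝ) ≤ (max b.1 b.2 : ℕ) := by exact_mod_cast hm
    simp_rw [height_le_iff (by linarith : 0 ≤ B) ha0 hm, ← hy]
    rw [← Finset.card_filter, card_filter_coprimePairs_max_le]
    exact Nat.floor_le_floor ((div_le_self hy0 hm1).trans hyB)
  rw [Finset.card_filter, Finset.sum_product, Finset.sum_congr rfl h1,
    sum_coprimePairs_max a ⌊B⌋₊ fun m => (coprimePairs a ⌊y / m⌋₊).card]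
  push_cast
  simp only [smul_eq_mul]
  push_cast
  symm
  -- For `m > y` the inner box has side `⌊y/m⌋ = 0`, so extending the range to `⌊B⌋` adds nothing.
  refine Finset.sum_subset (Finset.Ioc_subset_Ioc_right (Nat.floor_le_floor hyB)) ?_
  intro m hm hm'
  have : ⌊y / m⌋₊ = 0 := by
    rw [Nat.floor_div_natCast]
    refine Nat.div_eq_of_lt ?_
    simp only [Finset.mem_Ioc] at hm hm'
    lia
  simp [this, coprimePairs]

/-- Writing `a = d e` separates the sum into `∑ d^{-3/2}` and a harmonic sum. -/
theorem sum_invSqrtDivisorSum_div_le {B : ℝ} (hB : 1 ≤ B) :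
    ∑ a ∈ Finset.Ioc 0 ⌊B⌋₊, invSqrtDivisorSum a / a ≤ zetaThreeHalves * (1 + Real.log B) := by
  have h0 : ∑ a ∈ Finset.Ioc 0 ⌊B⌋₊, invSqrtDivisorSum a / a =
      ∑ a ∈ Finset.Ioc 0 ⌊B⌋₊, ∑ d ∈ a.divisors,
        1 / ((d : ℝ) * √d) * (1 / ((a / d : ℕ) : ℝ)) := by
    refine Finset.sum_congr rfl fun a ha => ?_
    rw [invSqrtDivisorSum, Finset.sum_div]
    refine Finset.sum_congr rfl fun d hd => ?_
    have hd0 : (d : ℝ) ≠ 0 := by exact_mod_cast (Nat.pos_of_mem_divisors hd).ne'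
    rw [Nat.cast_div (Nat.dvd_of_mem_divisors hd) hd0]
    field_simp
  rw [h0, sum_Ioc_floor_sum_divisors
    (fun d e => 1 / ((d : ℝ) * √d) * (1 / (e : ℝ)))]
  have h1 := sum_Ioc_floor_one_div hB
  calc _ ≤ ∑ d ∈ Finset.Ioc 0 ⌊B⌋₊, 1 / ((d : ℝ) * √d) * (1 + Real.log B) := by
        refine Finset.sum_le_sum fun d hd => ?_
        rw [← Finset.mul_sum]
        gcongr
        have hd1 : (1 : ℝ) ≤ d := by exact_mod_cast (Finset.mem_Ioc.1 hd).1
        have h2 : ∑ e ∈ Finset.Ioc 0 ⌊B / d⌋₊, 1 / (e : ℝ) ≤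
            ∑ e ∈ Finset.Ioc 0 ⌊B⌋₊, 1 / (e : ℝ) := by
          refine Finset.sum_le_sum_of_subset_of_nonneg (Finset.Ioc_subset_Ioc_right
            (Nat.floor_le_floor (div_le_self (by linarith) hd1))) fun _ _ _ => by positivity
        linarith [(abs_le.1 h1).2]
    _ ≤ _ := by
        rw [← Finset.sum_mul]
        have : 0 ≤ Real.log B := Real.log_nonneg hB
        gcongr
        exact sum_one_div_mul_sqrt_le _

theorem abs_card_heightTuples_sub_le {B : ℝ} (hB : 1 ≤ B) :
    |((heightTuples B).card : ℝ) -
      B * ∑ a ∈ Finset.Ioc 0 ⌊B⌋₊, pairDensity a ^ 2 * (Real.log (B / a) / a)| ≤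
      (15 + 3 * zetaThreeHalves) * (1 + 2 * zetaThreeHalves) * zetaThreeHalves *
        (B * (1 + Real.log B)) := by
  have hZ := zetaThreeHalves_nonneg
  rw [card_heightTuples hB, Finset.mul_sum, ← Finset.sum_sub_distrib]
  refine (Finset.abs_sum_le_sum_abs _ _).trans ?_
  calc _ ≤ ∑ a ∈ Finset.Ioc 0 ⌊B⌋₊, (15 + 3 * zetaThreeHalves) * (1 + 2 * zetaThreeHalves) * B *
        (invSqrtDivisorSum a / a) := by
        refine Finset.sum_le_sum fun a ha => ?_
        have ha0 : (0 : ℝ) < a := by exact_mod_cast (Finset.mem_Ioc.1 ha).1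
        have haB : (a : ℝ) ≤ B := (Nat.le_floor_iff (by linarith)).1 (Finset.mem_Ioc.1 ha).2
        have h1 : 1 ≤ B / a := by rwa [one_le_div ha0]
        -- With `y = √(B/a)` one has `y² = B/a`, and the 2 in the hyperbola main term cancels
        -- against `log y = log(B/a)/2`.
        have h := abs_sum_maxPairCount_sub_le (Finset.mem_Ioc.1 ha).1.ne' (Real.one_le_sqrt.2 h1)
        rw [Real.sq_sqrt (by linarith), Real.log_sqrt (by linarith)] at h
        have e : B * (pairDensity a ^ 2 * (Real.log (B / a) / a)) =
            2 * pairDensity a ^ 2 * (B / a) * (Real.log (B / a) / 2) := by ring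
        rw [e]
        exact h.trans (le_of_eq (by ring))
    _ = (15 + 3 * zetaThreeHalves) * (1 + 2 * zetaThreeHalves) * B *
        ∑ a ∈ Finset.Ioc 0 ⌊B⌋₊, invSqrtDivisorSum a / a := by rw [Finset.mul_sum]
    _ ≤ (15 + 3 * zetaThreeHalves) * (1 + 2 * zetaThreeHalves) * B *
        (zetaThreeHalves * (1 + Real.log B)) := by
        gcongr
        exact sum_invSqrtDivisorSum_div_le hB
    _ = _ := by ring

/-! ### The mean value of the squared density. -/

/-- The multiplicative function `n ↦ 1 / √n` on the natural numbers. -/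
noncomputable def natInvSqrtHom : ℕ →* ℝ where
  toFun n := 1 / √(n : ℝ)
  map_one' := by simp
  map_mul' m n := by push_cast; rw [Real.sqrt_mul (by positivity), one_div_mul_one_div]

theorem natInvSqrtHom_apply (n : ℕ) : natInvSqrtHom n = 1 / √(n : ℝ) := rfl

/-- The values at primes of the function whose divisor sum is proportional to the square of
`pairDensity`. -/
noncomputable def sqDensityWeight (p : ℕ) : ℝ := (1 + 1 / (p : ℝ))⁻¹ ^ 2 - 1

theorem abs_sqDensityWeight_le (p : ℕ) : |sqDensityWeight p| ≤ 2 * (1 / (p : ℝ)) := by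
  unfold sqDensityWeight
  have hu : 0 ≤ 1 / (p : ℝ) := by positivity
  set u := 1 / (p : ℝ)
  have h1 : (1 + u)⁻¹ ^ 2 - 1 = -((2 * u + u ^ 2) / (1 + u) ^ 2) := by
    field_simp
    ring
  rw [h1, abs_neg, abs_of_nonneg (by positivity), div_le_iff₀ (by positivity)]
  have : 0 ≤ u ^ 3 := by positivity
  nlinarith

theorem pairDensity_sq_eq {a : ℕ} (ha : a ≠ 0) :
    pairDensity a ^ 2 = coprimeDensity ^ 2 * ∑ d ∈ a.divisors, sqfreeProd sqDensityWeight d := by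
  rw [pairDensity_eq ha, sum_divisors_sqfreeProd _ ha, mul_pow, ← Finset.prod_pow]
  congr 1
  refine Finset.prod_congr rfl fun p _ => ?_
  rw [sqDensityWeight]
  ring

theorem summable_sqDensityWeight_mul_inv : Summable fun n => |sqDensityWeight n * natInvHom n| := by
  refine Summable.of_nonneg_of_le (fun _ => abs_nonneg _) (fun n => ?_)
    (summable_one_div_mul_sqrt.mul_left 2)
  rw [abs_mul, natInvHom_apply, abs_of_nonneg (by positivity : 0 ≤ 1 / (n : ℝ))]
  calc _ ≤ 2 * (1 / (n : ℝ)) * (1 / (n : ℝ)) := by gcongr; exact abs_sqDensityWeight_le n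
    _ = 2 * (1 / (n : ℝ) ^ 2) := by ring
    _ ≤ _ := mul_le_mul_of_nonneg_left (one_div_sq_le n) zero_le_two

/-- The weights are `O(1/p)`, so the associated series converges even at exponent 1/2. This leaves
room to absorb a factor `log d` into `√d`. -/
theorem summable_sqDensityWeight_mul_inv_sqrt :
    Summable fun n => |sqDensityWeight n * natInvSqrtHom n| := by
  refine Summable.of_nonneg_of_le (fun _ => abs_nonneg _) (fun n => ?_)
    (summable_one_div_mul_sqrt.mul_left 2)
  rw [abs_mul, natInvSqrtHom_apply, abs_of_nonneg (by positivity : 0 ≤ 1 / √(n : ℝ))]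
  calc _ ≤ 2 * (1 / (n : ℝ)) * (1 / √(n : ℝ)) := by gcongr; exact abs_sqDensityWeight_le n
    _ = _ := by rw [mul_assoc, one_div_mul_one_div]

theorem one_add_log_le_two_mul_sqrt {n : ℕ} (hn : n ≠ 0) : 1 + Real.log n ≤ 2 * √(n : ℝ) := by
  have h0 : (0 : ℝ) < n := by exact_mod_cast Nat.pos_of_ne_zero hn
  have h1 := Real.log_le_sub_one_of_pos (Real.sqrt_pos.2 h0)
  rw [Real.log_sqrt h0.le] at h1
  linarith

/-- Uniform in `d`: when `d > B` the sum is empty, and `log B < log d` bounds the main term by the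
error. -/
theorem abs_sum_log_div_div_sub_le {B : ℝ} (hB : 1 ≤ B) {d : ℕ} (hd : d ≠ 0) :
    |∑ e ∈ Finset.Ioc 0 ⌊B / d⌋₊, Real.log (B / d / e) / e - Real.log B ^ 2 / 2| ≤
      (1 + Real.log B) * (1 + Real.log d) := by
  have hd1 : (1 : ℝ) ≤ d := by exact_mod_cast Nat.pos_of_ne_zero hd
  have hlB := Real.log_nonneg hB
  have hld := Real.log_nonneg hd1
  rcases le_or_gt (d : ℝ) B with h | h
  · have h1 := abs_sum_log_div_sub_le (x := B / d) (by rwa [one_le_div (by linarith)])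
    have hlog := Real.log_le_log (by linarith) h
    rw [Real.log_div (by linarith) (by linarith)] at h1
    rw [abs_le] at h1 ⊢
    constructor <;> nlinarith
  · have h1 : ⌊B / d⌋₊ = 0 := by
      rw [Nat.floor_eq_zero, div_lt_one (by linarith)]
      exact h
    have hlog := Real.log_le_log (by linarith) h.le
    rw [h1]
    simp only [Finset.Ioc_self, Finset.sum_empty, zero_sub, abs_neg]
    rw [abs_of_nonneg (by positivity)]
    nlinarith

/-- The mean value of the square of `pairDensity`. -/
noncomputable def meanSqDensity : ℝ :=
  coprimeDensity ^ 2 * ∑' d : ℕ, sqfreeProd (fun p => sqDensityWeight p * natInvHom p) d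

theorem exists_abs_sum_pairDensity_sq_sub_le : ∃ C : ℝ, ∀ B : ℝ, 1 ≤ B →
    |∑ a ∈ Finset.Ioc 0 ⌊B⌋₊, pairDensity a ^ 2 * (Real.log (B / a) / a) -
      meanSqDensity * (Real.log B ^ 2 / 2)| ≤ C * (1 + Real.log B) := by
  set S := ∑' n, |sqfreeProd (fun p => sqDensityWeight p * natInvSqrtHom p) n|
  refine ⟨coprimeDensity ^ 2 * (2 * S), fun B hB => ?_⟩
  have hlB := Real.log_nonneg hB
  have h1 : ∑ a ∈ Finset.Ioc 0 ⌊B⌋₊, pairDensity a ^ 2 * (Real.log (B / a) / a) =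
      coprimeDensity ^ 2 * ∑ d ∈ Finset.Ioc 0 ⌊B⌋₊,
        sqfreeProd (fun p => sqDensityWeight p * natInvHom p) d *
          ∑ e ∈ Finset.Ioc 0 ⌊B / d⌋₊, Real.log (B / d / e) / e := by
    simp_rw [Finset.mul_sum]
    rw [← sum_Ioc_floor_sum_divisors (fun d e => coprimeDensity ^ 2 *
      (sqfreeProd (fun p => sqDensityWeight p * natInvHom p) d * (Real.log (B / d / e) / e)))]
    refine Finset.sum_congr rfl fun a ha => ?_
    rw [pairDensity_sq_eq (Finset.mem_Ioc.1 ha).1.ne', Finset.mul_sum, Finset.sum_mul]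
    refine Finset.sum_congr rfl fun d hd => ?_
    have hd0 : (d : ℝ) ≠ 0 := by exact_mod_cast (Nat.pos_of_mem_divisors hd).ne'
    have ha0 : (a : ℝ) ≠ 0 := by exact_mod_cast (Finset.mem_Ioc.1 ha).1.ne'
    rw [Nat.cast_div (Nat.dvd_of_mem_divisors hd) hd0, sqfreeProd_mul_map, natInvHom_apply,
      show B / d / ((a : ℝ) / d) = B / a by field_simp]
    field_simp
  -- Terms with `d > B` vanish, so the finite sum becomes a series comparable term by term with the
  -- one defining `meanSqDensity`.
  have h2 : HasSum (fun d : ℕ => sqfreeProd (fun p => sqDensityWeight p * natInvHom p) d *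
      ∑ e ∈ Finset.Ioc 0 ⌊B / d⌋₊, Real.log (B / d / e) / e)
      (∑ d ∈ Finset.Ioc 0 ⌊B⌋₊, sqfreeProd (fun p => sqDensityWeight p * natInvHom p) d *
          ∑ e ∈ Finset.Ioc 0 ⌊B / d⌋₊, Real.log (B / d / e) / e) := by
    refine hasSum_sum_of_ne_finset_zero fun d hd => ?_
    rw [Finset.mem_Ioc] at hd
    rw [Nat.floor_div_natCast]
    rcases Nat.eq_zero_or_pos d with rfl | h0
    · simp
    · rw [Nat.div_eq_of_lt (by lia : ⌊B⌋₊ < d)]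
      simp
  have h3 := (summable_sqfreeProd summable_sqDensityWeight_mul_inv).of_abs.hasSum.mul_right
    (Real.log B ^ 2 / 2)
  have h4 := h2.sub h3
  have h5 := tsum_of_norm_bounded (f := fun d : ℕ =>
      sqfreeProd (fun p => sqDensityWeight p * natInvHom p) d *
      ∑ e ∈ Finset.Ioc 0 ⌊B / d⌋₊, Real.log (B / d / e) / e -
      sqfreeProd (fun p => sqDensityWeight p * natInvHom p) d * (Real.log B ^ 2 / 2))
    ((summable_sqfreeProd summable_sqDensityWeight_mul_inv_sqrt).hasSum.mul_left
      (2 * (1 + Real.log B))) (by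
    intro d
    rcases Nat.eq_zero_or_pos d with rfl | h0
    · simp [sqfreeProd_zero]
    have hd0 : (0 : ℝ) < d := by exact_mod_cast h0
    have hs := Real.sqrt_pos.2 hd0
    rw [Real.norm_eq_abs, ← mul_sub, abs_mul, sqfreeProd_mul_map, sqfreeProd_mul_map, abs_mul,
      abs_mul, natInvHom_apply, natInvSqrtHom_apply,
      abs_of_nonneg (by positivity : 0 ≤ 1 / (d : ℝ)),
      abs_of_nonneg (by positivity : 0 ≤ 1 / √(d : ℝ))]
    calc _ ≤ |sqfreeProd sqDensityWeight d| * (1 / d) *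
          ((1 + Real.log B) * (2 * √(d : ℝ))) := by
          gcongr
          refine (abs_sum_log_div_div_sub_le hB h0.ne').trans ?_
          gcongr
          exact one_add_log_le_two_mul_sqrt h0.ne'
      _ = 2 * (1 + Real.log B) * (|sqfreeProd sqDensityWeight d| * (√(d : ℝ) / √(d : ℝ) ^ 2)) := by
          rw [Real.sq_sqrt hd0.le]
          ring
      _ = _ := by
          congr 2
          field_simp)
  rw [h4.tsum_eq, Real.norm_eq_abs] at h5
  rw [h1, meanSqDensity, mul_assoc, ← mul_sub, abs_mul, abs_of_nonneg (by positivity),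
    mul_assoc]
  gcongr
  refine h5.trans (le_of_eq ?_)
  ring

/-! ### The leading constant. -/

theorem hasProd_eulerFactor : HasProd eulerFactor meanSqDensity := by
  have h := (hasProd_coprimeDensity.mul hasProd_coprimeDensity).mul
    (hasProd_sqfreeProd summable_sqDensityWeight_mul_inv)
  have key : ∀ p : Nat.Primes, (1 - 1 / (p : ℝ) ^ 2) * (1 - 1 / (p : ℝ) ^ 2) *
      (1 + sqDensityWeight p * natInvHom p) = eulerFactor p := by
    intro p
    have hp : (0 : ℝ) < p := by exact_mod_cast p.2.pos
    rw [sqDensityWeight, natInvHom_apply, eulerFactor]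
    field_simp
    ring
  simp_rw [key, ← sq] at h
  exact h

theorem eulerFactor_pos (p : Nat.Primes) : 0 < eulerFactor p := by
  have hp : (2 : ℝ) ≤ p := by exact_mod_cast p.2.two_le
  have h1 : 1 / (p : ℝ) ≤ 1 / 2 := by gcongr
  have h0 : 0 < 1 / (p : ℝ) := by positivity
  rw [eulerFactor, ← one_div_pow, ← one_div_pow, show 2 / (p : ℝ) = 2 * (1 / p) by ring]
  set u := 1 / (p : ℝ)
  have h3 : u ^ 2 ≤ u := by nlinarith
  have h4 : u ^ 3 ≤ u := by nlinarith [sq_nonneg u]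
  have h5 : 0 < (1 - u) ^ 2 := by
    have : 0 < 1 - u := by linarith
    positivity
  apply mul_pos h5
  linarith

/-- The terms linear in `1/p` cancel, which is why the product converges absolutely. -/
theorem abs_eulerFactor_sub_one_le (p : Nat.Primes) :
    |eulerFactor p - 1| ≤ 9 * (1 / ((p : ℝ) * √p)) := by
  have hp : (2 : ℝ) ≤ p := by exact_mod_cast p.2.two_le
  have h1 : 1 / (p : ℝ) ≤ 1 / 2 := by gcongr
  have h0 : 0 < 1 / (p : ℝ) := by positivity
  refine le_trans ?_ (mul_le_mul_of_nonneg_left (one_div_sq_le p) (by norm_num))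
  rw [eulerFactor, ← one_div_pow, ← one_div_pow, show 2 / (p : ℝ) = 2 * (1 / p) by ring]
  set u := 1 / (p : ℝ)
  have h3 : (1 - u) ^ 2 * (1 + 2 * u - u ^ 2 - u ^ 3) - 1 =
      u ^ 2 * (-4 + 3 * u + u ^ 2 - u ^ 3) := by ring
  rw [h3, abs_mul, abs_of_nonneg (by positivity), mul_comm]
  gcongr
  have h4 : 0 < u ^ 2 := by positivity
  have h5 : 0 < u ^ 3 := by positivity
  have h6 : u ^ 2 ≤ 1 := by nlinarith
  have h7 : u ^ 3 ≤ 1 := by nlinarith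
  rw [abs_le]
  constructor <;> linarith

/-- Positivity of the factors alone gives only a nonnegative limit; absolute convergence excludes
the limit 0. -/
theorem meanSqDensity_pos : 0 < meanSqDensity := by
  have h0 : 0 ≤ meanSqDensity := ge_of_tendsto' hasProd_eulerFactor fun s =>
    Finset.prod_nonneg fun p _ => (eulerFactor_pos p).le
  refine lt_of_le_of_ne h0 fun h => ?_
  have h1 := tprod_one_add_ne_zero_of_summable (f := fun p => eulerFactor p - 1)
    (fun p => by simpa using (eulerFactor_pos p).ne')
    (Summable.of_nonneg_of_le (fun p => norm_nonneg _) abs_eulerFactor_sub_one_le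
      ((summable_one_div_mul_sqrt.mul_left 9).comp_injective Subtype.val_injective))
  simp only [add_sub_cancel] at h1
  exact h1 (hasProd_eulerFactor.tprod_eq.trans h.symm)

theorem leadingConstant_eq : leadingConstant = 4 * meanSqDensity := by
  rw [leadingConstant, hasProd_eulerFactor.tprod_eq]

theorem exists_abs_card_heightTuples_sub_le : ∃ C : ℝ, ∀ B : ℝ, 1 ≤ B →
    |8 * ((heightTuples B).card : ℝ) - leadingConstant * B * Real.log B ^ 2| ≤
      C * (B * (1 + Real.log B)) := by
  obtain ⟨C, hC⟩ := exists_abs_sum_pairDensity_sq_sub_le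
  refine ⟨8 * ((15 + 3 * zetaThreeHalves) * (1 + 2 * zetaThreeHalves) * zetaThreeHalves) + 8 * C,
    fun B hB => ?_⟩
  have h1 := abs_card_heightTuples_sub_le hB
  have h2 := hC B hB
  rw [leadingConstant_eq]
  set S := ∑ a ∈ Finset.Ioc 0 ⌊B⌋₊, pairDensity a ^ 2 * (Real.log (B / a) / a)
  set T := ((heightTuples B).card : ℝ)
  calc _ = |8 * (T - B * S) + 8 * B * (S - meanSqDensity * (Real.log B ^ 2 / 2))| := by
        congr 1; ring
    _ ≤ 8 * ((15 + 3 * zetaThreeHalves) * (1 + 2 * zetaThreeHalves) * zetaThreeHalves *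
        (B * (1 + Real.log B))) + 8 * B * (C * (1 + Real.log B)) := by
        refine (abs_add_le _ _).trans ?_
        rw [abs_mul, abs_mul, abs_of_nonneg (by positivity : (0 : ℝ) ≤ 8 * B)]
        norm_num only [abs_of_nonneg]
        gcongr
    _ = _ := by ring

/-! ### Coprime integral coordinates on the projective line. -/

namespace ProjLine

theorem coordVanishes_mk {K : Type} [Field K] (i : Fin 2) (v : Fin 2 → K) (hv : v ≠ 0) :
    CoordVanishes i (Projectivization.mk K v hv) ↔ v i = 0 := Iff.rfl

theorem coords_spec (x : ProjLine ℚ) : IsCoprime (x.coords 0) (x.coords 1) ∧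
    ∃ h : (fun i => (x.coords i : ℚ)) ≠ 0,
      x = Projectivization.mk ℚ (fun i => (x.coords i : ℚ)) h :=
  (exists_coprime_coords x).choose_spec

theorem coordVanishes_iff (x : ProjLine ℚ) (i : Fin 2) : x.CoordVanishes i ↔ x.coords i = 0 := by
  obtain ⟨-, h, hx⟩ := x.coords_spec
  conv_lhs => rw [hx]
  rw [coordVanishes_mk]
  exact Int.cast_eq_zero

theorem reduction_coordVanishes_iff (p : ℕ) [Fact p.Prime] (x : ProjLine ℚ) (i : Fin 2) :
    (x.reduction p).CoordVanishes i ↔ p ∣ (x.coords i).natAbs := by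
  rw [reduction, coordVanishes_mk, ZMod.intCast_zmod_eq_zero_iff_dvd, Int.natCast_dvd]

/-- Coprime integral coordinates of a point are unique up to sign. -/
theorem coords_mk {v : Fin 2 → ℤ} (hv : IsCoprime (v 0) (v 1))
    (h : (fun i => (v i : ℚ)) ≠ 0) :
    ∃ ε : ℤ, (ε = 1 ∨ ε = -1) ∧
      ∀ i, (coords (Projectivization.mk ℚ (fun i => (v i : ℚ)) h)) i = ε * v i := by
  set x : ProjLine ℚ := Projectivization.mk ℚ (fun i => (v i : ℚ)) h
  obtain ⟨hc, h', hx⟩ := x.coords_spec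
  obtain ⟨t, ht⟩ := (Projectivization.mk_eq_mk_iff' ℚ _ _ h' h).1 hx.symm
  have e : ∀ i, t * (v i : ℚ) = x.coords i := fun i => congrFun ht i
  have ecross : x.coords 0 * v 1 = x.coords 1 * v 0 := by
    have : (x.coords 0 * v 1 : ℚ) = x.coords 1 * v 0 := by rw [← e 0, ← e 1]; ring
    exact_mod_cast this
  obtain ⟨r, s, hrs⟩ := hv
  obtain ⟨r', s', hrs'⟩ := hc
  -- Applying the Bézout relation for `v` to the coordinates of `x` gives the candidate sign; the
  -- relation for `x` exhibits its inverse, so it is a unit of `ℤ`.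
  have e0 : x.coords 0 = (r * x.coords 0 + s * x.coords 1) * v 0 := by
    linear_combination -x.coords 0 * hrs + s * ecross
  have e1 : x.coords 1 = (r * x.coords 0 + s * x.coords 1) * v 1 := by
    linear_combination -x.coords 1 * hrs - r * ecross
  refine ⟨r * x.coords 0 + s * x.coords 1, ?_, ?_⟩
  · refine Int.isUnit_iff.1 (IsUnit.of_mul_eq_one (r' * v 0 + s' * v 1) ?_)
    linear_combination hrs' - r' * e0 - s' * e1
  · intro i
    fin_cases i
    exacts [e0, e1]

/-- The sign of the quotient of the coordinates, and the absolute values of the coordinates. -/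
noncomputable def signedCoords (x : ProjLine ℚ) : Bool × ℕ × ℕ :=
  (decide (0 < x.coords 0 * x.coords 1), (x.coords 0).natAbs, (x.coords 1).natAbs)

theorem signedCoords_injOn :
    Set.InjOn signedCoords {x | ∀ i, ¬ x.CoordVanishes i} := by
  intro x hx y hy hxy
  simp only [Set.mem_ofPred_eq, coordVanishes_iff] at hx hy
  simp only [signedCoords, Prod.mk.injEq, decide_eq_decide] at hxy
  obtain ⟨hs, h0, h1⟩ := hxy
  have hx0 := hx 0
  have hx1 := hx 1
  have hε : ∃ ε : ℤ, ∀ i, ε * y.coords i = x.coords i := by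
    rcases Int.natAbs_eq_natAbs_iff.1 h0 with h0 | h0 <;>
      rcases Int.natAbs_eq_natAbs_iff.1 h1 with h1 | h1
    · exact ⟨1, fun i => by fin_cases i <;> simp [h0, h1]⟩
    -- If exactly one coordinate changes sign, the product changes sign, contradicting `hs`.
    · rw [h0, h1] at hs
      have : y.coords 0 * y.coords 1 ≠ 0 := mul_ne_zero (hy 0) (hy 1)
      rw [mul_neg, Left.neg_pos_iff] at hs
      rcases this.lt_or_gt with h | h
      exacts [absurd (hs.1 h) h.le.not_gt, absurd (hs.2 h) h.le.not_gt]
    · rw [h0, h1] at hs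
      have : y.coords 0 * y.coords 1 ≠ 0 := mul_ne_zero (hy 0) (hy 1)
      rw [neg_mul, Left.neg_pos_iff] at hs
      rcases this.lt_or_gt with h | h
      exacts [absurd (hs.1 h) h.le.not_gt, absurd (hs.2 h) h.le.not_gt]
    · exact ⟨-1, fun i => by fin_cases i <;> simp [h0, h1]⟩
  obtain ⟨ε, hε⟩ := hε
  obtain ⟨-, hvx, ex⟩ := x.coords_spec
  obtain ⟨-, hvy, ey⟩ := y.coords_spec
  rw [ex, ey, Projectivization.mk_eq_mk_iff']
  refine ⟨ε, funext fun i => ?_⟩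
  simp only [Pi.smul_apply, smul_eq_mul]
  exact_mod_cast hε i

theorem exists_signedCoords_eq (s : Bool) {u v : ℕ} (hu : 0 < u) (hv : 0 < v)
    (huv : u.Coprime v) : ∃ x : ProjLine ℚ, x.signedCoords = (s, u, v) := by
  obtain ⟨w, hw, hs⟩ : ∃ w : ℤ, w.natAbs = u ∧ (0 < w * v ↔ s = true) := by
    have hv' : (0 : ℤ) < v := by exact_mod_cast hv
    cases s
    · refine ⟨-u, by simp, ?_⟩
      simp only [Bool.false_eq_true, iff_false, not_lt]
      nlinarith
    · refine ⟨u, by simp, ?_⟩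
      simp only [iff_true]
      positivity
  have hc : IsCoprime w (v : ℤ) := by
    rw [Int.isCoprime_iff_gcd_eq_one, Int.gcd, hw, Int.natAbs_natCast]
    exact huv
  have hne : (fun i => ((![w, (v : ℤ)] i : ℤ) : ℚ)) ≠ 0 := by
    intro h
    have := congrFun h 1
    simp at this
    lia
  obtain ⟨ε, hε, hcoords⟩ := coords_mk (v := ![w, (v : ℤ)]) hc hne
  refine ⟨Projectivization.mk ℚ _ hne, Prod.ext ?_ (Prod.ext ?_ ?_)⟩
  · simp only [signedCoords, hcoords]
    rw [Bool.eq_iff_iff, ← hs, decide_eq_true_iff]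
    rcases hε with rfl | rfl <;> simp
  · simp only [signedCoords, hcoords]
    rcases hε with rfl | rfl <;> simp [hw]
  · simp only [signedCoords, hcoords]
    rcases hε with rfl | rfl <;> simp

end ProjLine

/-! ### Integral points correspond to signs and tuples. -/

/-- All factors of the height are at least 1, so the height bound already implies the box
constraints by `⌊B⌋`. -/
theorem mem_heightTuples {B : ℝ} {a b₀ b₁ c₀ c₁ : ℕ} :
    (⟨a, (b₀, b₁), (c₀, c₁)⟩ : (_ : ℕ) × ((ℕ × ℕ) × (ℕ × ℕ))) ∈ heightTuples B ↔
      0 < a ∧ (0 < b₀ ∧ 0 < b₁ ∧ b₀.Coprime b₁ ∧ b₁.Coprime a) ∧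
      (0 < c₀ ∧ 0 < c₁ ∧ c₀.Coprime c₁ ∧ c₁.Coprime a) ∧
      (a : ℝ) * (max b₀ b₁ : ℕ) ^ 2 * (max c₀ c₁ : ℕ) ^ 2 ≤ B := by
  simp only [heightTuples, coprimePairs, Finset.mem_sigma, Finset.mem_filter, Finset.mem_product,
    Finset.mem_Ioc]
  constructor
  · rintro ⟨⟨h1, -⟩, ⟨⟨⟨⟨h2, -⟩, h3, -⟩, h4, h5⟩, ⟨⟨h6, -⟩, h7, -⟩, h8, h9⟩, h10⟩
    exact ⟨h1, ⟨h2, h3, h4, h5⟩, ⟨h6, h7, h8, h9⟩, h10⟩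
  · rintro ⟨h1, ⟨h2, h3, h4, h5⟩, ⟨h6, h7, h8, h9⟩, h10⟩
    have hm : 1 ≤ max b₀ b₁ := by lia
    have hn : 1 ≤ max c₀ c₁ := by lia
    have key : a * max b₀ b₁ ^ 2 * max c₀ c₁ ^ 2 ≤ ⌊B⌋₊ := Nat.le_floor (by exact_mod_cast h10)
    have hm2 : max b₀ b₁ ≤ max b₀ b₁ ^ 2 := Nat.le_self_pow (by norm_num) _
    have hn2 : max c₀ c₁ ≤ max c₀ c₁ ^ 2 := Nat.le_self_pow (by norm_num) _
    have hm3 : 0 < max b₀ b₁ ^ 2 := by positivity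
    have hn3 : 0 < max c₀ c₁ ^ 2 := by positivity
    have k1 : a * max b₀ b₁ ^ 2 ≤ ⌊B⌋₊ := (Nat.le_mul_of_pos_right _ hn3).trans key
    have k2 : a ≤ ⌊B⌋₊ := (Nat.le_mul_of_pos_right _ hm3).trans k1
    have k3 : max b₀ b₁ ^ 2 ≤ ⌊B⌋₊ := (Nat.le_mul_of_pos_left _ h1).trans k1
    have k4 : max c₀ c₁ ^ 2 ≤ ⌊B⌋₊ :=
      (Nat.le_mul_of_pos_left _ (Nat.mul_pos h1 hm3)).trans key
    refine ⟨⟨h1, k2⟩, ⟨⟨⟨⟨h2, ?_⟩, h3, ?_⟩, h4, h5⟩, ⟨⟨h6, ?_⟩, h7, ?_⟩, h8, h9⟩, h10⟩ <;> lia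

namespace TripleLine

theorem height_eq (P : TripleLine ℚ) : P.height =
    ((P.a.coords 1).natAbs : ℝ) * (max (P.b.coords 0).natAbs (P.b.coords 1).natAbs : ℕ) ^ 2 *
      (max (P.c.coords 0).natAbs (P.c.coords 1).natAbs : ℕ) ^ 2 := by
  simp only [height, Nat.cast_max, Nat.cast_natAbs, Int.cast_abs]

theorem inTorus_iff (P : TripleLine ℚ) : P.InTorus ↔
    ((∀ i, ¬ P.a.CoordVanishes i) ∧ (∀ i, ¬ P.b.CoordVanishes i) ∧
      ∀ i, ¬ P.c.CoordVanishes i) := by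
  simp only [InTorus, forall_and]

/-- On the torus the generic condition is automatic. The conditions modulo all primes say that no
prime divides `a₀`, and none divides `a₁` together with `b₁` or with `c₁`. -/
theorem mem_integralPoints_iff {P : TripleLine ℚ} (hP : P.InTorus) : P ∈ integralPoints ↔
    (P.a.coords 0).natAbs = 1 ∧ (P.b.coords 1).natAbs.Coprime (P.a.coords 1).natAbs ∧
      (P.c.coords 1).natAbs.Coprime (P.a.coords 1).natAbs := by
  have h0 : ¬ P.OnBoundary := by
    rintro (h | ⟨h, -⟩ | ⟨h, -⟩)
    exacts [(hP 0).1 h, (hP 1).1 h, (hP 1).1 h]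
  rw [integralPoints, Set.mem_ofPred_eq, and_iff_right h0]
  simp only [OnBoundary, reduction, ProjLine.reduction_coordVanishes_iff, not_or]
  constructor
  · intro h
    refine ⟨?_, ?_, ?_⟩
    · rw [Nat.eq_one_iff_not_exists_prime_dvd]
      intro p hp
      have := Fact.mk hp
      exact (h p).1
    · by_contra hc
      obtain ⟨p, hp, h1, h2⟩ := Nat.Prime.not_coprime_iff_dvd.1 hc
      have := Fact.mk hp
      exact (h p).2.1 ⟨h2, h1⟩
    · by_contra hc
      obtain ⟨p, hp, h1, h2⟩ := Nat.Prime.not_coprime_iff_dvd.1 hc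
      have := Fact.mk hp
      exact (h p).2.2 ⟨h2, h1⟩
  · rintro ⟨h1, h2, h3⟩ p hp
    refine ⟨?_, fun h => ?_, fun h => ?_⟩
    · rw [h1]
      exact hp.out.one_lt.ne' ∘ Nat.dvd_one.1
    · exact Nat.Prime.not_coprime_iff_dvd.2 ⟨p, hp.out, h.2, h.1⟩ h2
    · exact Nat.Prime.not_coprime_iff_dvd.2 ⟨p, hp.out, h.2, h.1⟩ h3

/-- The signs of the three coordinates of a point of the torus, and the absolute values of its
coprime integral coordinates except for `a₀`. -/
noncomputable def signsAndTuple (P : TripleLine ℚ) :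
    (Bool × Bool × Bool) × ((_ : ℕ) × ((ℕ × ℕ) × (ℕ × ℕ))) :=
  ((P.a.signedCoords.1, P.b.signedCoords.1, P.c.signedCoords.1),
    ⟨P.a.signedCoords.2.2, P.b.signedCoords.2, P.c.signedCoords.2⟩)

end TripleLine

/-- Omitting `|a₀|` loses nothing because integrality makes it 1; the three signs are free and
account for the factor 8. -/
theorem bijOn_signsAndTuple (B : ℝ) :
    Set.BijOn TripleLine.signsAndTuple (pointsOfBoundedHeight B)
      (Finset.univ ×ˢ heightTuples B :
        Finset ((Bool × Bool × Bool) × ((_ : ℕ) × ((ℕ × ℕ) × (ℕ × ℕ))))) := by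
  have hcop : ∀ x : ProjLine ℚ, (x.coords 0).natAbs.Coprime (x.coords 1).natAbs := fun x =>
    Int.isCoprime_iff_gcd_eq_one.1 x.coords_spec.1
  refine ⟨?_, ?_, ?_⟩
  · rintro P ⟨hP, hT, hB⟩
    obtain ⟨-, h2, h3⟩ := (TripleLine.mem_integralPoints_iff hT).1 hP
    obtain ⟨ha, hb, hc⟩ := P.inTorus_iff.1 hT
    simp only [ProjLine.coordVanishes_iff] at ha hb hc
    rw [TripleLine.height_eq] at hB
    simp only [Finset.coe_product, Finset.coe_univ, Set.mem_prod, Set.mem_univ, true_and,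
      Finset.mem_coe]
    exact mem_heightTuples.2 ⟨Int.natAbs_pos.2 (ha 1),
      ⟨Int.natAbs_pos.2 (hb 0), Int.natAbs_pos.2 (hb 1), hcop _, h2⟩,
      ⟨Int.natAbs_pos.2 (hc 0), Int.natAbs_pos.2 (hc 1), hcop _, h3⟩, hB⟩
  · rintro P ⟨hP, hT, -⟩ Q ⟨hQ, hT', -⟩ h
    obtain ⟨h1, -⟩ := (TripleLine.mem_integralPoints_iff hT).1 hP
    obtain ⟨h1', -⟩ := (TripleLine.mem_integralPoints_iff hT').1 hQ
    obtain ⟨ha, hb, hc⟩ := P.inTorus_iff.1 hT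
    obtain ⟨ha', hb', hc'⟩ := Q.inTorus_iff.1 hT'
    simp only [TripleLine.signsAndTuple, Prod.mk.injEq, Sigma.mk.injEq, heq_eq_eq] at h
    obtain ⟨⟨s1, s2, s3⟩, t1, t2, t3⟩ := h
    have e1 : P.a = Q.a := ProjLine.signedCoords_injOn ha ha'
      (Prod.ext s1 (Prod.ext (h1.trans h1'.symm) t1))
    have e2 : P.b = Q.b := ProjLine.signedCoords_injOn hb hb' (Prod.ext s2 t2)
    have e3 : P.c = Q.c := ProjLine.signedCoords_injOn hc hc' (Prod.ext s3 t3)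
    cases P
    cases Q
    simp_all
  · rintro ⟨⟨s1, s2, s3⟩, ⟨a, ⟨b₀, b₁⟩, ⟨c₀, c₁⟩⟩⟩ h
    simp only [Finset.coe_product, Finset.coe_univ, Set.mem_prod, Set.mem_univ, true_and,
      Finset.mem_coe] at h
    obtain ⟨ha, ⟨hb0, hb1, hb, hba⟩, ⟨hc0, hc1, hc, hca⟩, hB⟩ := mem_heightTuples.1 h
    obtain ⟨x, hx⟩ := ProjLine.exists_signedCoords_eq s1 one_pos ha (Nat.coprime_one_left a)
    obtain ⟨y, hy⟩ := ProjLine.exists_signedCoords_eq s2 hb0 hb1 hb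
    obtain ⟨z, hz⟩ := ProjLine.exists_signedCoords_eq s3 hc0 hc1 hc
    refine ⟨⟨x, y, z⟩, ?_, by simp [TripleLine.signsAndTuple, hx, hy, hz]⟩
    simp only [ProjLine.signedCoords, Prod.mk.injEq] at hx hy hz
    obtain ⟨-, hx0, hx1⟩ := hx
    obtain ⟨-, hy0, hy1⟩ := hy
    obtain ⟨-, hz0, hz1⟩ := hz
    have hT : TripleLine.InTorus ⟨x, y, z⟩ := by
      rw [TripleLine.inTorus_iff]
      simp only [ProjLine.coordVanishes_iff, Fin.forall_fin_two, ← Int.natAbs_eq_zero]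
      lia
    refine ⟨(TripleLine.mem_integralPoints_iff hT).2 ⟨hx0, ?_, ?_⟩, hT, ?_⟩
    · rw [hy1, hx1]; exact hba
    · rw [hz1, hx1]; exact hca
    · rw [TripleLine.height_eq, hx1, hy0, hy1, hz0, hz1]; exact hB

theorem pointsOfBoundedHeight_finite (B : ℝ) : (pointsOfBoundedHeight B).Finite :=
  (bijOn_signsAndTuple B).finite_iff_finite.2 (Finset.finite_toSet _)

theorem countingFunction_eq (B : ℝ) : countingFunction B = 8 * (heightTuples B).card := by
  have h := bijOn_signsAndTuple B
  rw [countingFunction, ← h.injOn.ncard_image, h.image_eq, Set.ncard_coe_finset,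
    Finset.card_product]
  rfl

theorem theorem1p1 :
    (∀ B : ℝ, (pointsOfBoundedHeight B).Finite) ∧
    Multipliable eulerFactor ∧ 0 < leadingConstant ∧
    (fun B : ℝ => (countingFunction B : ℝ) - leadingConstant * B * Real.log B ^ 2)
      =O[Filter.atTop]
        (fun B : ℝ => B * Real.log B * Real.log (Real.log B) ^ 3) := by
  refine ⟨pointsOfBoundedHeight_finite, hasProd_eulerFactor.multipliable, ?_, ?_⟩
  · rw [leadingConstant_eq]
    exact mul_pos four_pos meanSqDensity_pos
  obtain ⟨C, hC⟩ := exists_abs_card_heightTuples_sub_le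
  have hlog : ∀ᶠ B : ℝ in Filter.atTop, 1 ≤ Real.log (Real.log B) :=
    (Real.tendsto_log_atTop.comp Real.tendsto_log_atTop).eventually_ge_atTop 1
  have hlog' : ∀ᶠ B : ℝ in Filter.atTop, 1 ≤ Real.log B :=
    Real.tendsto_log_atTop.eventually_ge_atTop 1
  -- The 2 absorbs `1 + log B ≤ 2 log B`; the factor `(log log B)³` is only used as being at least
  -- 1.
  refine Asymptotics.IsBigO.of_bound (|C| * 2) ?_
  filter_upwards [hlog, hlog', Filter.eventually_ge_atTop 1] with B h1 h2 h3
  rw [countingFunction_eq, Real.norm_eq_abs, Real.norm_eq_abs]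
  push_cast
  rw [abs_of_nonneg (by positivity : 0 ≤ B * Real.log B * Real.log (Real.log B) ^ 3)]
  calc _ ≤ C * (B * (1 + Real.log B)) := hC B h3
    _ ≤ |C| * (B * (1 + Real.log B)) := by gcongr; exact le_abs_self C
    _ ≤ |C| * (B * (2 * Real.log B)) := by gcongr; linarith
    _ = |C| * 2 * (B * Real.log B * 1 ^ 3) := by ring
    _ ≤ _ := by gcongr
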